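/- Let $W$ be the Weyl group of a nonzero (crystallographic) root system spanning a real vector space $E$ of dimension $l\ge 1$, with a $W$-invariant inner product $(\ ,\ )$ on $E$. For a finite group $G$ let $R(G)$ be the Grothendieck group of its finite-dimensional complex representations, with the character pairing $\langle\chi,\psi\rangle_G=\frac1{|G|}\sum_{g}\chi(g)\psi(g^{-1})$. Let $\langle\sigma,\sigma'\rangle^{\mathrm{ell}}_W=\frac1{|W|}\sum_{w\in W}\sigma(w)\sigma'(w)\det_E(1-w)$ be the elliptic pairing on $R(W)$ and $\overline R(W)=R(W)/\mathrm{rad}\langle\ ,\ \rangle_W^{\mathrm{ell}}$. The elliptic fake degree of a class $[\pi]\in\overline R(W)$ is the rational function $$F_{[\pi]}=\frac{(q-1)^l}{|W|}\sum_{w\in W}\pi(w)\,\frac{\det_E(1-w)}{\det_E(1-qw)}.$$ Let $C(E)$ be the Clifford algebra with relations $\xi\xi'+\xi'\xi=-2(\xi,\xi')$, let $\epsilon$ be its automorphism equal to $+1$ on $C(E)_{\mathrm{even}}$ and $-1$ on $C(E)_{\mathrm{odd}}$, and ${}^t$ its anti-automorphism with $\xi^t=-\xi$ for $\xi\in E$.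 Let $\mathrm{Pin}(E)=\{a\in C(E)^\times:\epsilon(a)Ea^{-1}\subset E,\ a^t=a^{-1}\}$ and $p:\mathrm{Pin}(E)\to O(E)$, $p(a)(\xi)=\epsilon(a)\xi a^{-1}$. Put $\widetilde W=p^{-1}(W)$, and let $\widetilde W'=\widetilde W$ if $l$ is odd and $\widetilde W'=\widetilde W\cap C(E)_{\mathrm{even}}$ if $l$ is even. Let $S^+,S^-$ be the two inequivalent simple complex modules of $C(E)$ if $l$ is odd, respectively of $C(E)_{\mathrm{even}}$ if $l$ is even (in either order), restricted to $\widetilde W'$. A representation of $\widetilde W'$ is genuine if $-1$ acts by $-1$. Two representations $\tau^\pm$ of $\widetilde W'$ are associate if $\tau^-\cong\tau^+\otimes(\det\circ p)$ when $l$ is odd, and if $\tau^-$ is isomorphic to the conjugate of $\tau^+$ by the elements of $\widetilde W\setminus\widetilde W'$ when $l$ is even; they are orthogonal if $\langle\tau^+,\tau^-\rangle_{\widetilde W'}=0$. Then for every class $[\pi]\in\overline R(W)$ there is a pair $(\widetilde\sigma^+_\pi,\widetilde\sigma^-_\pi)$, unique up to isomorphism, of associate, orthogonal genuine $\widetilde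 W'$-representations such that $\pi'\otimes(S^+-S^-)=\widetilde\sigma^+_\pi-\widetilde\sigma^-_\pi$ for every representative $\pi'\in R(W)$ of $[\pi]$, and for every representative $\pi$ of the class $$F_{[\pi]}=\tfrac12\,(q-1)^l\,\big\langle\widetilde\sigma^+_\pi-\widetilde\sigma^-_\pi,\ S_qE\otimes(S^+-S^-)\big\rangle_{\widetilde W'},$$ where $S_qE=\sum_{i\ge0}q^iS^iE$, the pairing is extended $q$-linearly, so that the right-hand side is a formal power series in $q$, and the left-hand side is identified with its expansion at $q=0$. -/

import Mathlib

noncomputable section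

open scoped PowerSeries

namespace EllipticSpin

/-! ### Characters of finite groups -/

section Characters

variable (G : Type*) [Group G]

/-- `χ` is the character of a finite-dimensional complex representation of `G`. -/
def IsCharacter (χ : G → ℂ) : Prop :=
  ∃ (n : ℕ) (ρ : Representation ℂ G (Fin n → ℂ)), ρ.character = χ

/-- The Grothendieck group `R(G)` of finite-dimensional complex representations of a finite group
`G`, realised as the group of virtual characters. -/
def virtualCharacters : AddSubgroup (G → ℂ) :=
  AddSubgroup.closure {χ | IsCharacter G χ}

variable {G}

/-- The character pairing `⟨χ, ψ⟩_G = |G|⁻¹ ∑_g χ(g) ψ(g⁻¹)`; for characters of representations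
`V` and `U` of a finite group it is the dimension of `Hom_G(U, V)`. -/
def charPairing (χ ψ : G → ℂ) : ℂ :=
  (Nat.card G : ℂ)⁻¹ * ∑ᶠ g : G, χ g * ψ g⁻¹

end Characters

/-! ### Elliptic representation theory of a finite linear group -/

section Elliptic

variable {E : Type*} [AddCommGroup E] [Module ℝ E]

/-- `det_E(1 - w)`. -/
def detOneSub (w : E ≃ₗ[ℝ] E) : ℝ :=
  LinearMap.det (1 - (w : E →ₗ[ℝ] E))

/-- The polynomial `det_E(1 - q w)` in `q`, with coefficients viewed in `ℂ`
(`Matrix.charpolyRev M` is `det (1 - X • M)`). -/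
def detOneSubX [FiniteDimensional ℝ E] (w : E ≃ₗ[ℝ] E) : Polynomial ℂ :=
  (LinearMap.toMatrix (Module.finBasis ℝ E) (Module.finBasis ℝ E)
    (w : E →ₗ[ℝ] E)).charpolyRev.map (algebraMap ℝ ℂ)

variable (W : Subgroup (E ≃ₗ[ℝ] E))

variable {W} in
/-- The elliptic pairing `|W|⁻¹ ∑_w σ(w) τ(w) det(1 - w)`. -/
def ellipticPairing (σ τ : W → ℂ) : ℂ :=
  (Nat.card W : ℂ)⁻¹ * ∑ᶠ w : W, σ w * τ w * (detOneSub (w : E ≃ₗ[ℝ] E) : ℂ)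

/-- The radical of the elliptic pairing on `R(W)`. -/
def ellipticRadical [Finite W] : AddSubgroup (virtualCharacters W) where
  carrier := {σ | ∀ τ : virtualCharacters W, ellipticPairing (σ : W → ℂ) (τ : W → ℂ) = 0}
  zero_mem' := fun τ => by simp [ellipticPairing]
  add_mem' := fun {a b} ha hb τ => by
    have h := congrArg₂ (· + ·) (ha τ) (hb τ)
    simp only [ellipticPairing, add_zero] at h ⊢
    rw [← mul_add, ← finsum_add_distrib (Set.toFinite _) (Set.toFinite _)] at h
    simpa [add_mul] using h
  neg_mem' := fun {a} ha τ => by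
    have h := congrArg Neg.neg (ha τ)
    simp only [ellipticPairing, neg_zero] at h ⊢
    rw [← mul_neg, ← finsum_neg_distrib] at h
    simpa using h

/-- The group `R̄(W) = R(W) / rad` of virtual elliptic representations. -/
abbrev EllipticQuotient [Finite W] : Type _ :=
  virtualCharacters W ⧸ ellipticRadical W

variable {W} in
/-- The elliptic fake degree
`F_{[π]} = (q-1)^l |W|⁻¹ ∑_w π(w) det(1-w) / det(1-qw)`, a rational function of `q`. -/
def ellipticFakeDegree [FiniteDimensional ℝ E] (π : W → ℂ) : RatFunc ℂ :=
  (RatFunc.X - 1) ^ Module.finrank ℝ E *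
    (RatFunc.C (Nat.card W : ℂ)⁻¹ *
      ∑ᶠ w : W, RatFunc.C (π w * (detOneSub (w : E ≃ₗ[ℝ] E) : ℂ)) /
        algebraMap (Polynomial ℂ) (RatFunc ℂ) (detOneSubX (w : E ≃ₗ[ℝ] E)))

end Elliptic

/-! ### Symmetric powers -/

section SymPow

variable {k V : Type*} [Field k] [AddCommGroup V] [Module k V]

variable (k V) in
/-- The symmetric power `S^i V`, as the degree `i` part of the symmetric algebra. -/
def symPow (i : ℕ) : Submodule k (SymmetricAlgebra k V) :=
  LinearMap.range (SymmetricAlgebra.ι k V) ^ i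

/-- The algebra endomorphism of the symmetric algebra induced by a linear endomorphism. -/
def symMap (f : V →ₗ[k] V) : SymmetricAlgebra k V →ₐ[k] SymmetricAlgebra k V :=
  SymmetricAlgebra.lift (SymmetricAlgebra.ι k V ∘ₗ f)

theorem symMap_mem_symPow (f : V →ₗ[k] V) (i : ℕ) :
    ∀ x ∈ symPow k V i, (symMap f).toLinearMap x ∈ symPow k V i := by
  have h1 : (LinearMap.range (SymmetricAlgebra.ι k V)).map (symMap f).toLinearMap ≤
      LinearMap.range (SymmetricAlgebra.ι k V) := by
    rintro _ ⟨_, ⟨v, rfl⟩, rfl⟩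
    exact ⟨f v, by simp [symMap]⟩
  intro x hx
  have h2 : (symPow k V i).map (symMap f).toLinearMap ≤ symPow k V i := by
    unfold symPow
    rw [Submodule.map_pow]
    exact pow_le_pow_left' h1 i
  exact h2 ⟨x, hx, rfl⟩

/-- The endomorphism of `S^i V` induced by a linear endomorphism of `V`. -/
def symPowMap (f : V →ₗ[k] V) (i : ℕ) : symPow k V i →ₗ[k] symPow k V i :=
  (symMap f).toLinearMap.restrict (symMap_mem_symPow f i)

end SymPow

/-- The character of `W` on the symmetric power `S^i E` of its (complexified) reflection
representation; `S_q E = ∑ q^i S^i E` has graded character `∑ q^i symPowCharacter W i`. -/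
def symPowCharacter {E : Type*} [AddCommGroup E] [Module ℝ E] (W : Subgroup (E ≃ₗ[ℝ] E))
    (i : ℕ) (w : W) : ℂ :=
  LinearMap.trace ℂ _
    (symPowMap (LinearMap.baseChange ℂ ((w : E ≃ₗ[ℝ] E) : E →ₗ[ℝ] E)) i)

/-! ### Clifford algebra, pin group and pin covers -/

section Clifford

variable (E : Type*) [NormedAddCommGroup E] [InnerProductSpace ℝ E]

/-- The quadratic form `ξ ↦ -(ξ, ξ)`. -/
def cliffordForm : QuadraticForm ℝ E :=
  -LinearMap.BilinMap.toQuadraticMap (innerₗ E)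

/-- The Clifford algebra `C(E)`, with relations `ξ ξ' + ξ' ξ = -2 (ξ, ξ')`. -/
abbrev Cl : Type _ := CliffordAlgebra (cliffordForm E)

/-- The inclusion of `E` in `C(E)`. -/
abbrev clι : E →ₗ[ℝ] Cl E := CliffordAlgebra.ι (cliffordForm E)

theorem clι_mul_add_swap (x y : E) :
    clι E x * clι E y + clι E y * clι E x = algebraMap ℝ (Cl E) (-2 * inner ℝ x y) := by
  rw [CliffordAlgebra.ι_mul_ι_add_swap]
  congr 1
  simp only [QuadraticMap.polar, cliffordForm, neg_apply,
    LinearMap.BilinMap.toQuadraticMap_apply, innerₗ_apply_apply, inner_add_left, inner_add_right,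
    real_inner_comm x y]
  ring

theorem clι_injective : Function.Injective (clι E) := by
  intro x y h
  have h' := congrArg (CliffordAlgebra.equivExterior (cliffordForm E)) h
  simpa [CliffordAlgebra.equivExterior, CliffordAlgebra.changeFormEquiv,
    CliffordAlgebra.changeForm_ι] using h'

/-- The twisted conjugation `x ↦ ε(a) x a⁻¹`. -/
def twistedConj (a : (Cl E)ˣ) : Cl E →ₗ[ℝ] Cl E :=
  LinearMap.mulLeft ℝ (CliffordAlgebra.involute (a : Cl E)) ∘ₗ
    LinearMap.mulRight ℝ ((a⁻¹ : (Cl E)ˣ) : Cl E)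

theorem twistedConj_apply (a : (Cl E)ˣ) (x : Cl E) :
    twistedConj E a x = CliffordAlgebra.involute (a : Cl E) * x * ((a⁻¹ : (Cl E)ˣ) : Cl E) := by
  simp [twistedConj, mul_assoc]

theorem twistedConj_one : twistedConj E 1 = LinearMap.id := by
  ext x
  simp [twistedConj_apply]

theorem twistedConj_mul (a b : (Cl E)ˣ) :
    twistedConj E (a * b) = twistedConj E a ∘ₗ twistedConj E b := by
  refine LinearMap.ext fun x => ?_
  simp [twistedConj_apply, mul_assoc]

/-- `C(E)` if `dim E` is odd, and the even part of `C(E)` if `dim E` is even. -/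
def spinAlgebra : Subalgebra ℝ (Cl E) :=
  open Classical in
  if Odd (Module.finrank ℝ E) then ⊤ else CliffordAlgebra.even (cliffordForm E)

theorem star_mem_spinAlgebra {x : Cl E} (hx : x ∈ spinAlgebra E) : star x ∈ spinAlgebra E := by
  unfold spinAlgebra at *
  split_ifs at * with h
  · trivial
  · rw [← Subalgebra.mem_toSubmodule, CliffordAlgebra.even_toSubmodule] at *
    rw [CliffordAlgebra.star_def, CliffordAlgebra.reverse_mem_evenOdd_iff,
      CliffordAlgebra.involute_mem_evenOdd_iff]
    exact hx

variable [FiniteDimensional ℝ E]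

/-- The pin group `{a ∈ C(E)ˣ : ε(a) E a⁻¹ ⊆ E, aᵗ = a⁻¹}`; here `star` is the anti-automorphism
`ᵗ` of `C(E)` with `ξᵗ = -ξ` for `ξ ∈ E`, and `involute` is `ε`. -/
def Pin : Subgroup (Cl E)ˣ where
  carrier := {a | (∀ ξ : E, CliffordAlgebra.involute (a : Cl E) * clι E ξ *
      ((a⁻¹ : (Cl E)ˣ) : Cl E) ∈ LinearMap.range (clι E)) ∧
    star (a : Cl E) = ((a⁻¹ : (Cl E)ˣ) : Cl E)}
  one_mem' := ⟨fun ξ => by simp, by simp⟩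
  mul_mem' := by
    rintro a b ⟨ha, ha'⟩ ⟨hb, hb'⟩
    refine ⟨fun ξ => ?_, by simp [ha', hb']⟩
    obtain ⟨η, hη⟩ := hb ξ
    have := ha η
    rw [hη] at this
    simpa [mul_assoc] using this
  inv_mem' := by
    rintro a ⟨ha, ha'⟩
    refine ⟨fun ξ => ?_, by rw [inv_inv, ← ha', star_star]⟩
    have hle : (LinearMap.range (clι E)).map (twistedConj E a) ≤ LinearMap.range (clι E) := by
      rintro _ ⟨_, ⟨v, rfl⟩, rfl⟩
      rw [twistedConj_apply]
      exact ha v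
    have hinv : ∀ x, twistedConj E a⁻¹ (twistedConj E a x) = x := fun x => by
      rw [← LinearMap.comp_apply, ← twistedConj_mul, inv_mul_cancel, twistedConj_one]
      rfl
    have hinj : Function.Injective (twistedConj E a) := fun x y h => by
      rw [← hinv x, h, hinv]
    have heq := Submodule.eq_of_le_of_finrank_eq hle
      (Submodule.equivMapOfInjective _ hinj _).finrank_eq.symm
    have hξ : clι E ξ ∈ LinearMap.range (clι E) := ⟨ξ, rfl⟩
    rw [← heq] at hξ
    obtain ⟨y, hy, hy'⟩ := hξ
    rw [← twistedConj_apply, ← hy', hinv]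
    exact hy

variable {E}

/-- The linear map `p(a) : E → E`, `p(a)(ξ) = ε(a) ξ a⁻¹`, for `a` in the pin group. -/
def pinAct (a : Pin E) : E →ₗ[ℝ] E :=
  (LinearEquiv.ofInjective (clι E) (clι_injective E)).symm.toLinearMap ∘ₗ
    LinearMap.codRestrict (LinearMap.range (clι E)) (twistedConj E (a : (Cl E)ˣ) ∘ₗ clι E)
      (fun ξ => by
        rw [LinearMap.comp_apply, twistedConj_apply]
        exact a.2.1 ξ)

theorem clι_pinAct (a : Pin E) (ξ : E) :
    clι E (pinAct a ξ) = CliffordAlgebra.involute ((a : (Cl E)ˣ) : Cl E) * clι E ξ *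
      (((a : (Cl E)ˣ)⁻¹ : (Cl E)ˣ) : Cl E) := by
  rw [← twistedConj_apply]
  have h := LinearEquiv.apply_symm_apply (LinearEquiv.ofInjective (clι E) (clι_injective E))
    ⟨twistedConj E (a : (Cl E)ˣ) (clι E ξ), by rw [twistedConj_apply]; exact a.2.1 ξ⟩
  exact congrArg Subtype.val h

variable (E)

/-- The homomorphism `p` from the pin group to the linear automorphisms of `E`. -/
def pinHom : Pin E →* (E ≃ₗ[ℝ] E) :=
  (LinearMap.GeneralLinearGroup.generalLinearEquiv ℝ E).toMonoidHom.comp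
    (MonoidHom.toHomUnits (M := Module.End ℝ E)
      { toFun := pinAct
        map_one' := by
          refine LinearMap.ext fun ξ => clι_injective E ?_
          rw [clι_pinAct]
          simp
        map_mul' := fun a b => by
          refine LinearMap.ext fun ξ => clι_injective E ?_
          rw [Module.End.mul_apply, clι_pinAct, clι_pinAct, clι_pinAct]
          simp [mul_assoc] })

theorem clι_pinHom (a : Pin E) (ξ : E) :
    clι E (pinHom E a ξ) = CliffordAlgebra.involute ((a : (Cl E)ˣ) : Cl E) * clι E ξ *
      (((a : (Cl E)ˣ)⁻¹ : (Cl E)ˣ) : Cl E) :=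
  clι_pinAct a ξ

variable {E}
variable (W : Subgroup (E ≃ₗ[ℝ] E))

/-- The pin cover `W̃ = p⁻¹(W)` of `W`. -/
def pinCover : Subgroup (Pin E) :=
  W.comap (pinHom E)

/-- The group `W̃'`: it is `W̃` if `dim E` is odd and `W̃ ∩ C(E)_even` if `dim E` is even. -/
def pinCover' : Subgroup (Pin E) where
  carrier := {a | a ∈ pinCover W ∧ ((a : (Cl E)ˣ) : Cl E) ∈ spinAlgebra E}
  one_mem' := ⟨one_mem _, by simp⟩
  mul_mem' := fun ha hb => ⟨mul_mem ha.1 hb.1, by simpa using mul_mem ha.2 hb.2⟩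
  inv_mem' := fun {a} ha => ⟨inv_mem ha.1, by
    have := star_mem_spinAlgebra E ha.2
    rw [a.2.2] at this
    simpa using this⟩

/-- The projection `W̃' → W`. -/
def coverProj : pinCover' W →* W :=
  ((pinHom E).comp (pinCover' W).subtype).codRestrict W (fun a => a.2.1)

/-- An element of `W̃'`, as an element of `C(E)` (`dim E` odd) or `C(E)_even` (`dim E` even). -/
def toSpinAlgebra (g : pinCover' W) : spinAlgebra E :=
  ⟨(((g : Pin E) : (Cl E)ˣ) : Cl E), g.2.2⟩

/-- `χ` is the character of a genuine representation of `W̃'`: `-1` acts by `-1`. -/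
def IsGenuineCharacter (χ : pinCover' W → ℂ) : Prop :=
  ∃ (n : ℕ) (ρ : Representation ℂ (pinCover' W) (Fin n → ℂ)),
    (∀ z : pinCover' W, (((z : Pin E) : (Cl E)ˣ) : Cl E) = -1 → ρ z = -1) ∧ ρ.character = χ

/-- Two characters of `W̃'` are associate. If `dim E` is odd, this means that they differ by the
twist with the sign character `det ∘ p` of `W̃' = W̃`; if `dim E` is even, that they are conjugate
under the elements of `W̃` outside the index two subgroup `W̃'`. -/
def IsAssociate (χ₁ χ₂ : pinCover' W → ℂ) : Prop :=
  (Odd (Module.finrank ℝ E) → ∀ g : pinCover' W,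
    χ₂ g = ((LinearMap.det ((coverProj W g : E ≃ₗ[ℝ] E) : E →ₗ[ℝ] E) : ℝ) : ℂ) * χ₁ g) ∧
  (Even (Module.finrank ℝ E) → ∀ x ∈ pinCover W, x ∉ pinCover' W →
    ∀ g h : pinCover' W, (h : Pin E) = x * g * x⁻¹ → χ₂ h = χ₁ g)

end Clifford

/-! ### Spin modules and the map `ι` -/

section Spin

variable {A : Type*} [Ring A] [Algebra ℝ A]

/-- A complex module `S` over the real algebra `A`, given by `ρ`, is simple. -/
def IsSimpleModuleHom {S : Type*} [AddCommGroup S] [Module ℂ S]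
    (ρ : A →ₐ[ℝ] Module.End ℂ S) : Prop :=
  Nontrivial S ∧ ∀ U : Submodule ℂ S, (∀ a : A, ∀ v ∈ U, ρ a v ∈ U) → U = ⊥ ∨ U = ⊤

/-- Two complex modules over the real algebra `A` are isomorphic. -/
def AreIsomorphic {S T : Type*} [AddCommGroup S] [Module ℂ S] [AddCommGroup T] [Module ℂ T]
    (ρ : A →ₐ[ℝ] Module.End ℂ S) (τ : A →ₐ[ℝ] Module.End ℂ T) : Prop :=
  ∃ f : S ≃ₗ[ℂ] T, ∀ (a : A) (v : S), f (ρ a v) = τ a (f v)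

variable {E : Type*} [NormedAddCommGroup E] [InnerProductSpace ℝ E] [FiniteDimensional ℝ E]
  (W : Subgroup (E ≃ₗ[ℝ] E))

/-- The character of `W̃'` on the restriction of a complex module over `C(E)` (`dim E` odd) or
`C(E)_even` (`dim E` even). -/
def spinCharacter {S : Type*} [AddCommGroup S] [Module ℂ S]
    (ρ : spinAlgebra E →ₐ[ℝ] Module.End ℂ S) (g : pinCover' W) : ℂ :=
  LinearMap.trace ℂ S (ρ (toSpinAlgebra W g))

/-- `ι(π) = π ⊗ (S⁺ - S⁻)`, where `δ` is the virtual character `S⁺ - S⁻` of `W̃'`. -/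
def spinInduct (δ : pinCover' W → ℂ) (π : W → ℂ) : pinCover' W → ℂ :=
  fun g => π (coverProj W g) * δ g

/-- `σ = (σ⁺, σ⁻)` is a pair of (characters of) associate, orthogonal genuine representations of
`W̃'` such that `ι([π]) = σ⁺ - σ⁻`, i.e. `π' ⊗ (S⁺ - S⁻) = σ⁺ - σ⁻` for every `π' ∈ R(W)` in the
class `c = [π]`. Here `δ` is the virtual character `S⁺ - S⁻`. -/
structure IsSpinPair [Finite W] (δ : pinCover' W → ℂ) (c : EllipticQuotient W)
    (σ : (pinCover' W → ℂ) × (pinCover' W → ℂ)) : Prop where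
  genuine_fst : IsGenuineCharacter W σ.1
  genuine_snd : IsGenuineCharacter W σ.2
  associate : IsAssociate W σ.1 σ.2
  orthogonal : charPairing σ.1 σ.2 = 0
  induct_eq : ∀ π : virtualCharacters W, (QuotientAddGroup.mk π : EllipticQuotient W) = c →
    spinInduct W δ (π : W → ℂ) = σ.1 - σ.2

/-- The pairing `⟨χ, S_q E ⊗ δ⟩_{W̃'} = ∑_i q^i ⟨χ, S^i E ⊗ δ⟩_{W̃'}`. -/
def symPairing (χ δ : pinCover' W → ℂ) : ℂ⟦X⟧ :=
  PowerSeries.mk fun i => charPairing χ (spinInduct W δ (symPowCharacter W i))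

end Spin

/-! ### Weyl groups -/

section Weyl

variable {I E N : Type*} [AddCommGroup E] [Module ℝ E] [AddCommGroup N] [Module ℝ N]

/-- The Weyl group of a root system in `E`, as a group of linear automorphisms of `E`. -/
def weylGroup (P : RootPairing I ℝ E N) : Subgroup (E ≃ₗ[ℝ] E) :=
  Subgroup.closure (Set.range P.reflection)

instance finite_weylGroup [Finite I] (P : RootPairing I ℝ E N) [P.IsRootSystem] :
    Finite (weylGroup P) := by
  have key : ∀ w ∈ weylGroup P, ∀ i, w (P.root i) ∈ Set.range P.root := by
    intro w hw
    induction hw using Subgroup.closure_induction'' with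
    | one => exact fun i => ⟨i, rfl⟩
    | mem x hx =>
      obtain ⟨j, rfl⟩ := hx
      exact fun i => ⟨_, P.root_reflectionPerm j i⟩
    | inv_mem x hx =>
      obtain ⟨j, rfl⟩ := hx
      exact fun i => by
        rw [P.reflection_inv]
        exact ⟨_, P.root_reflectionPerm j i⟩
    | mul x y _ _ hx hy =>
      intro i
      obtain ⟨k, hk⟩ := hy i
      rw [LinearEquiv.mul_apply, ← hk]
      exact hx k
  refine Finite.of_injective
    (fun (w : weylGroup P) (i : I) => (⟨_, key w w.2 i⟩ : Set.range P.root)) ?_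
  intro w w' h
  have h' : ∀ i, (w : E ≃ₗ[ℝ] E) (P.root i) = (w' : E ≃ₗ[ℝ] E) (P.root i) := fun i =>
    congrArg Subtype.val (congrFun h i)
  apply Subtype.ext
  apply LinearEquiv.toLinearMap_injective
  apply LinearMap.ext_on_range (RootPairing.IsRootSystem.span_root_eq_top (P := P))
  exact h'

end Weyl

end EllipticSpin

end

open scoped PowerSeries LaurentSeries
open EllipticSpin

/-!
Write `δ = S⁺ - S⁻` and let `θ` be the identity of `C(E)` if `l` is odd and the automorphism `ε`
if `l` is even. The algebra acting on `S⁺` and `S⁻` is generated by an odd number of anticommuting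
elements of square `-1`, so a functional `T` on it with `T (a * b) = T (b * a)` is determined by
its values at `1` and at the product `φ` of the generators. The trace of `x ↦ a θ(x) b` on `C(E)`
has this property in `a` and in `b`, and it vanishes, as `δ(a) δ(b)` does, when one of `a`, `b` is
`1` and the other has the parity of `l`; hence the two are proportional when `a` or `b` has that
parity. If `g ∈ W̃'` has it, then `x ↦ g θ(x) g⁻¹` is the automorphism of `C(E)` extending `-p(g)`
and its trace is that of the exterior algebra of `-p(g)`, namely `det (1 - p(g))`; for the
remaining `g`, both `δ(g)` and `det (1 - p(g))` are zero. So `δ(g) δ(g⁻¹)` is a constant times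
`det (1 - p(g))`, and, up to a constant, `π ↦ π ⊗ δ` carries the elliptic pairing on `R(W)` to the
character pairing of `W̃'`.

In particular `π ⊗ δ` has norm zero, hence vanishes, for `π` in the radical. As a virtual
character is in only one way a difference of orthogonal characters, and `δ` changes sign under the
twist by `det ∘ p`, respectively under conjugation by `W̃ \ W̃'`, the two orthogonal parts of
`π ⊗ δ` are associate. The pairing of `π ⊗ δ` with `S_q E ⊗ δ` becomes the elliptic pairing of `π`
with `S_q E`, and the trace of `w` on `S_q E` is `1 / det (1 - q w)`.
-/

noncomputable section

open scoped PowerSeries TensorProduct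

namespace EllipticSpin

/-! ### Algebras generated by anticommuting elements -/

section Words

/-- The ordered product of those `f i` for which `I i` holds; the elements of an algebra generated
by the `f i` are expanded in these products. -/
def word {A : Type*} [Monoid A] {m : ℕ} (f : Fin m → A) (I : Fin m → Bool) : A :=
  (List.ofFn fun i => if I i then f i else 1).prod

theorem word_succ {A : Type*} [Monoid A] {m : ℕ} (f : Fin (m + 1) → A) (I : Fin (m + 1) → Bool) :
    word f I = (if I 0 then f 0 else 1) * word (Fin.tail f) (Fin.tail I) := by
  simp only [word, List.ofFn_succ, List.prod_cons, Fin.tail]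
  rfl

theorem word_false {A : Type*} [Monoid A] {m : ℕ} (f : Fin m → A) :
    word f (fun _ => false) = 1 := by
  simp [word]

theorem word_true {A : Type*} [Monoid A] {m : ℕ} (f : Fin m → A) :
    word f (fun _ => true) = (List.ofFn f).prod := by
  simp [word]

variable {k A : Type*} [CommRing k] [Ring A] [Algebra k A]

theorem map_ofFn_prod_of_map_eq_smul (F : A →ₐ[k] A) {m : ℕ} {y : Fin m → A} {s : Fin m → k}
    (h : ∀ i, F (y i) = s i • y i) : F (List.ofFn y).prod = (∏ i, s i) • (List.ofFn y).prod := by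
  induction m with
  | zero => simp
  | succ m ih =>
    rw [List.ofFn_succ, List.prod_cons, map_mul, h, ih fun i => h i.succ, Fin.prod_univ_succ,
      smul_mul_smul_comm]

theorem map_word_of_map_eq_smul (F : A →ₐ[k] A) {m : ℕ} {f : Fin m → A} {s : Fin m → k}
    (h : ∀ i, F (f i) = s i • f i) (I : Fin m → Bool) :
    F (word f I) = (∏ i, if I i then s i else 1) • word f I :=
  map_ofFn_prod_of_map_eq_smul F fun i => by cases hI : I i <;> simp [h]

theorem mul_ofFn_prod_of_mul_eq_smul {m : ℕ} {x : A} {y : Fin m → A} {s : Fin m → k}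
    (h : ∀ j, x * y j = s j • (y j * x)) :
    x * (List.ofFn y).prod = (∏ j, s j) • ((List.ofFn y).prod * x) := by
  induction m with
  | zero => simp
  | succ m ih =>
    rw [List.ofFn_succ, List.prod_cons, Fin.prod_univ_succ, ← mul_assoc, h 0, smul_mul_assoc,
      mul_assoc, ih fun j => h j.succ]
    simp [mul_smul, mul_assoc]

variable (k) in
theorem span_word_succ {m : ℕ} (f : Fin (m + 1) → A) :
    Submodule.span k (Set.range (word f)) =
      Submodule.span k (Set.range (word (Fin.tail f))) ⊔
        (Submodule.span k (Set.range (word (Fin.tail f)))).map (LinearMap.mulLeft k (f 0)) := by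
  rw [Submodule.map_span, ← Submodule.span_union, ← Set.range_comp]
  congr 1
  ext x
  constructor
  · rintro ⟨I, rfl⟩
    cases h : I 0
    · exact .inl ⟨Fin.tail I, by simp [word_succ, h]⟩
    · exact .inr ⟨Fin.tail I, by simp [word_succ, h]⟩
  · rintro (⟨I, rfl⟩ | ⟨I, rfl⟩)
    · exact ⟨Fin.cons false I, by simp [word_succ]⟩
    · exact ⟨Fin.cons true I, by simp [word_succ]⟩

theorem mul_mem_span_word {m : ℕ} {f : Fin m → A}
    (hsq : ∀ i, f i * f i ∈ (algebraMap k A).range)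
    (hswap : ∀ i j, f i * f j + f j * f i ∈ (algebraMap k A).range) (i : Fin m) {x : A}
    (hx : x ∈ Submodule.span k (Set.range (word f))) :
    f i * x ∈ Submodule.span k (Set.range (word f)) := by
  induction m generalizing x with
  | zero => exact i.elim0
  | succ m ih =>
    have ih (j : Fin m) {y : A} := ih (f := Fin.tail f) (fun i => hsq i.succ)
      (fun i j => hswap i.succ j.succ) j (x := y)
    rw [span_word_succ] at hx ⊢
    set M := Submodule.span k (Set.range (word (Fin.tail f)))
    obtain ⟨y, hy, _, ⟨z, hz, rfl⟩, rfl⟩ := Submodule.mem_sup.1 hx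
    have mem_left {w : A} (hw : w ∈ M) := Submodule.mem_sup_left (T := M.map (.mulLeft k (f 0))) hw
    have mem_right {w : A} (hw : w ∈ M) : f 0 * w ∈ M ⊔ M.map (.mulLeft k (f 0)) :=
      Submodule.mem_sup_right ⟨w, hw, rfl⟩
    rw [LinearMap.mulLeft_apply, mul_add, ← mul_assoc]
    cases i using Fin.cases with
    | zero =>
      obtain ⟨c, hc⟩ := hsq 0
      rw [← hc, ← Algebra.smul_def]
      exact add_mem (mem_right hy) (mem_left (M.smul_mem c hz))
    | succ j =>
      obtain ⟨c, hc⟩ := hswap j.succ 0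
      rw [eq_sub_of_add_eq hc.symm, sub_mul, ← Algebra.smul_def, mul_assoc]
      exact add_mem (mem_left (ih j hy))
        (sub_mem (mem_left (M.smul_mem c hz)) (mem_right (ih j hz)))

theorem span_word_eq_top {m : ℕ} {f : Fin m → A} (hsq : ∀ i, f i * f i ∈ (algebraMap k A).range)
    (hswap : ∀ i j, f i * f j + f j * f i ∈ (algebraMap k A).range)
    (hgen : Algebra.adjoin k (Set.range f) = ⊤) :
    Submodule.span k (Set.range (word f)) = ⊤ := by
  set M := Submodule.span k (Set.range (word f))
  suffices h : ∀ x ∈ Algebra.adjoin k (Set.range f), ∀ y ∈ M, x * y ∈ M from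
    (Submodule.eq_top_iff').2 fun x => by
      simpa using h x (hgen ▸ trivial) 1 (Submodule.subset_span ⟨_, word_false f⟩)
  intro x hx
  induction hx using Algebra.adjoin_induction with
  | mem x hx =>
    obtain ⟨i, rfl⟩ := hx
    exact fun y hy => mul_mem_span_word hsq hswap i hy
  | algebraMap r =>
    intro y hy
    rw [← Algebra.smul_def]
    exact M.smul_mem r hy
  | add a b _ _ ha hb =>
    intro y hy
    rw [add_mul]
    exact add_mem (ha y hy) (hb y hy)
  | mul a b _ _ ha hb =>
    intro y hy
    rw [mul_assoc]
    exact ha _ (hb y hy)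

theorem mul_eq_map_mul_of_adjoin_eq_top {s : Set A} (hs : Algebra.adjoin k s = ⊤)
    (F : A →ₐ[k] A) {φ : A} (h : ∀ x ∈ s, φ * x = F x * φ) (x : A) : φ * x = F x * φ := by
  have hx : x ∈ Algebra.adjoin k s := hs ▸ trivial
  induction hx using Algebra.adjoin_induction with
  | mem x hx => exact h x hx
  | algebraMap r => rw [AlgHom.commutes, Algebra.commutes]
  | add a b _ _ ha hb => rw [mul_add, ha, hb, map_add, add_mul]
  | mul a b _ _ ha hb => rw [← mul_assoc, ha, mul_assoc, hb, map_mul, mul_assoc]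

end Words

section CliffordSystem

/-- The elements `f i` anticommute and have square `-1`. -/
structure IsCliffordFamily {A : Type*} [Ring A] {m : ℕ} (f : Fin m → A) : Prop where
  sq : ∀ i, f i * f i = -1
  anti : ∀ i j, i ≠ j → f i * f j = -(f j * f i)

/-- A family of anticommuting square roots of `-1` that generates the algebra. Such a system of odd
length `m` exists in `C(E)` for `dim E` odd and in its even part for `dim E` even, which allows us
to treat the two cases together. -/
structure IsCliffordSystem (k : Type*) {A : Type*} [CommRing k] [Ring A] [Algebra k A] {m : ℕ}
    (f : Fin m → A) : Prop extends IsCliffordFamily f where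
  adjoin_eq_top : Algebra.adjoin k (Set.range f) = ⊤

namespace IsCliffordFamily

variable (k : Type*) {A : Type*} [CommRing k] [Ring A] [Algebra k A] {m : ℕ}

theorem tail {f : Fin (m + 1) → A} (hf : IsCliffordFamily f) : IsCliffordFamily (Fin.tail f) where
  sq i := hf.sq i.succ
  anti i j hij := hf.anti i.succ j.succ (by simpa using hij)

variable {f : Fin m → A}

theorem mul_word (hf : IsCliffordFamily f) (i : Fin m) (I : Fin m → Bool) :
    f i * word f I =
      ((∏ j, if I j then (-1 : k) else 1) * if I i then -1 else 1) • (word f I * f i) := by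
  have hprod : (∏ j, if I j then (-1 : k) else 1) * (if I i then -1 else 1) =
      ∏ j, (if I j then -1 else 1) * if j = i then (if I i then -1 else 1) else 1 := by
    rw [Finset.prod_mul_distrib, Finset.prod_ite_eq' Finset.univ i]
    simp
  rw [hprod]
  refine mul_ofFn_prod_of_mul_eq_smul fun j => ?_
  rcases eq_or_ne j i with rfl | hj
  · by_cases hI : I j <;> simp [hI]
  · by_cases hI : I j <;> simp [hI, hj, hf.anti i j hj.symm]

theorem mul_ofFn_prod (hf : IsCliffordFamily f) (i : Fin m) :
    f i * (List.ofFn f).prod = (-1 : k) ^ (m + 1) • ((List.ofFn f).prod * f i) := by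
  simpa [word_true, pow_succ] using hf.mul_word k i fun _ => true

theorem exists_ofFn_prod_mul_self (hf : IsCliffordFamily f) :
    ∃ η : k, η * η = 1 ∧ (List.ofFn f).prod * (List.ofFn f).prod = algebraMap k A η := by
  induction m with
  | zero => exact ⟨1, by simp⟩
  | succ m ih =>
    obtain ⟨η, hη, hw⟩ := ih hf.tail
    have hcons : (List.ofFn f).prod = f 0 * (List.ofFn (Fin.tail f)).prod := by
      rw [List.ofFn_succ, List.prod_cons]
      rfl
    have hcomm : f 0 * (List.ofFn (Fin.tail f)).prod =
        (-1 : k) ^ m • ((List.ofFn (Fin.tail f)).prod * f 0) := by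
      simpa using mul_ofFn_prod_of_mul_eq_smul (y := Fin.tail f) (s := fun _ => (-1 : k))
        fun j => by simp [Fin.tail, hf.anti 0 j.succ (Fin.succ_ne_zero j).symm]
    rw [hcons]
    set w := (List.ofFn (Fin.tail f)).prod
    have hsign : (-1 : k) ^ m * (-1) ^ m = 1 := by rw [← mul_pow]; simp
    refine ⟨-((-1) ^ m * η), by linear_combination hsign * (η * η) + hη, ?_⟩
    calc f 0 * w * (f 0 * w) = f 0 * w * ((-1 : k) ^ m • (w * f 0)) := by rw [hcomm]
      _ = (-1 : k) ^ m • (f 0 * (w * w) * f 0) := by simp [mul_assoc]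
      _ = (-1 : k) ^ m • (algebraMap k A η * (f 0 * f 0)) := by
        rw [hw, ← Algebra.commutes, mul_assoc]
      _ = algebraMap k A (-((-1) ^ m * η)) := by simp [hf.sq, Algebra.smul_def]

theorem exists_mul_word_eq_neg (hf : IsCliffordFamily f) {I : Fin m → Bool}
    (hfalse : I ≠ fun _ => false) (htrue : I ≠ fun _ => true) :
    ∃ i, f i * word f I = -(word f I * f i) := by
  obtain ⟨i, hi⟩ : ∃ i, I i = true := by
    by_contra! h
    exact hfalse (funext fun i => by simpa using h i)
  obtain ⟨j, hj⟩ : ∃ j, I j = false := by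
    by_contra! h
    exact htrue (funext fun j => by simpa using h j)
  have hsign : (∏ j, if I j then (-1 : ℤ) else 1) = 1 ∨
      (∏ j, if I j then (-1 : ℤ) else 1) = -1 := by
    simpa [Finset.prod_ite] using neg_one_pow_eq_or ℤ _
  rcases hsign with h | h
  · exact ⟨i, by simp [hf.mul_word ℤ, h, hi]⟩
  · exact ⟨j, by simp [hf.mul_word ℤ, h, hj]⟩

end IsCliffordFamily

namespace IsCliffordSystem

section CommRing

variable {k A : Type*} [CommRing k] [Ring A] [Algebra k A] {m : ℕ} {f : Fin m → A}

theorem span_word (hf : IsCliffordSystem k f) : Submodule.span k (Set.range (word f)) = ⊤ := by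
  refine span_word_eq_top (fun i => ⟨-1, by simp [hf.sq]⟩) (fun i j => ?_) hf.adjoin_eq_top
  rcases eq_or_ne i j with rfl | hij
  · exact ⟨-1 + -1, by simp [hf.sq]⟩
  · exact ⟨0, by simp [hf.anti i j hij]⟩

theorem commute_ofFn_prod (hf : IsCliffordSystem k f) (hm : Odd m) (x : A) :
    Commute (List.ofFn f).prod x :=
  mul_eq_map_mul_of_adjoin_eq_top hf.adjoin_eq_top (AlgHom.id k A) (by
    rintro _ ⟨i, rfl⟩
    simp [hf.mul_ofFn_prod k i, (hm.add_odd odd_one).neg_one_pow]) x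

end CommRing

section Tracial

variable {k A M : Type*} [Field k] [CharZero k] [Ring A] [Algebra k A] [AddCommGroup M]
  [Module k M] {m : ℕ} {f : Fin m → A}

theorem map_word_eq_zero_of_tracial (hf : IsCliffordSystem k f) {T : A →ₗ[k] M}
    (hT : ∀ u v, T (u * v) = T (v * u)) {I : Fin m → Bool}
    (hfalse : I ≠ fun _ => false) (htrue : I ≠ fun _ => true) : T (word f I) = 0 := by
  obtain ⟨i, hi⟩ := hf.exists_mul_word_eq_neg hfalse htrue
  have hconj : f i * word f I * f i = word f I := by
    rw [hi, neg_mul, mul_assoc, hf.sq, mul_neg_one, neg_neg]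
  have hneg : T (word f I) = -T (word f I) := by
    conv_lhs => rw [← hconj, hT, ← mul_assoc, hf.sq, neg_one_mul, map_neg]
  have htwo : (2 : k) • T (word f I) = 0 := by
    rw [two_smul]
    nth_rewrite 1 [hneg]
    exact neg_add_cancel _
  exact (smul_eq_zero.1 htwo).resolve_left two_ne_zero

theorem tracial_ext (hf : IsCliffordSystem k f) {T U : A →ₗ[k] M}
    (hT : ∀ u v, T (u * v) = T (v * u)) (hU : ∀ u v, U (u * v) = U (v * u))
    (hone : T 1 = U 1) (hprod : T (List.ofFn f).prod = U (List.ofFn f).prod) : T = U := by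
  refine LinearMap.ext_on_range hf.span_word fun I => ?_
  by_cases hfalse : I = fun _ => false
  · rw [hfalse, word_false, hone]
  by_cases htrue : I = fun _ => true
  · rw [htrue, word_true, hprod]
  rw [hf.map_word_eq_zero_of_tracial hT hfalse htrue,
    hf.map_word_eq_zero_of_tracial hU hfalse htrue]

theorem tracial_smul_eq {K : Type*} [CommRing K] [Algebra k K] (hf : IsCliffordSystem k f)
    {T U : A →ₗ[k] K} (hT : ∀ u v, T (u * v) = T (v * u)) (hU : ∀ u v, U (u * v) = U (v * u))
    (hT₁ : T 1 = 0) (hU₁ : U 1 = 0) (x : A) :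
    T (List.ofFn f).prod * U x = U (List.ofFn f).prod * T x :=
  LinearMap.congr_fun (hf.tracial_ext (T := T (List.ofFn f).prod • U)
    (U := U (List.ofFn f).prod • T) (fun u v => by simp [hU u v]) (fun u v => by simp [hT u v])
    (by simp [hT₁, hU₁]) (by simp [mul_comm])) x

end Tracial

end IsCliffordSystem

end CliffordSystem

/-! ### Simple modules over algebras generated by anticommuting elements -/

section Schur

variable {A : Type*} [Ring A] [Algebra ℝ A]
  {S T : Type*} [AddCommGroup S] [Module ℂ S] [AddCommGroup T] [Module ℂ T]

/-- The space of `A`-linear maps between two complex modules. -/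
def intertwiners (ρ : A →ₐ[ℝ] Module.End ℂ S) (τ : A →ₐ[ℝ] Module.End ℂ T) :
    Submodule ℂ (S →ₗ[ℂ] T) where
  carrier := {h | ∀ a v, τ a (h v) = h (ρ a v)}
  zero_mem' := fun a v => by simp
  add_mem' := fun hx hy a v => by simp [hx a v, hy a v]
  smul_mem' := fun c x hx a v => by simp [hx a v]

theorem exists_eq_smul_one_of_mem_intertwiners [FiniteDimensional ℂ S]
    {ρ : A →ₐ[ℝ] Module.End ℂ S} (hρ : IsSimpleModuleHom ρ) {h : S →ₗ[ℂ] S}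
    (hh : h ∈ intertwiners ρ ρ) : ∃ z : ℂ, h = z • 1 := by
  have := hρ.1
  obtain ⟨z, hz⟩ := Module.End.exists_eigenvalue h
  have hinv : ∀ a, ∀ v ∈ Module.End.eigenspace h z, ρ a v ∈ Module.End.eigenspace h z := by
    intro a v hv
    rw [Module.End.mem_eigenspace_iff] at hv ⊢
    rw [← hh a v, hv, map_smul]
  have htop := (hρ.2 _ hinv).resolve_left hz
  exact ⟨z, LinearMap.ext fun v => Module.End.mem_eigenspace_iff.1 (htop ▸ Submodule.mem_top)⟩

theorem finrank_intertwiners_self [FiniteDimensional ℂ S] {ρ : A →ₐ[ℝ] Module.End ℂ S}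
    (hρ : IsSimpleModuleHom ρ) : Module.finrank ℂ (intertwiners ρ ρ) = 1 := by
  have := hρ.1
  refine finrank_eq_one (⟨1, fun a v => rfl⟩ : intertwiners ρ ρ)
    (fun h => one_ne_zero (congrArg Subtype.val h)) ?_
  rintro ⟨h, hh⟩
  obtain ⟨z, rfl⟩ := exists_eq_smul_one_of_mem_intertwiners hρ hh
  exact ⟨z, rfl⟩

theorem intertwiners_eq_bot {ρ : A →ₐ[ℝ] Module.End ℂ S} {τ : A →ₐ[ℝ] Module.End ℂ T}
    (hρ : IsSimpleModuleHom ρ) (hτ : IsSimpleModuleHom τ) (hne : ¬ AreIsomorphic ρ τ) :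
    intertwiners ρ τ = ⊥ := by
  refine (Submodule.eq_bot_iff _).2 fun h hh => ?_
  by_contra h0
  have hker : LinearMap.ker h = ⊥ := by
    refine (hρ.2 (LinearMap.ker h) fun a v hv => ?_).resolve_right
      (h0 ∘ LinearMap.ker_eq_top.1)
    rw [LinearMap.mem_ker] at hv ⊢
    rw [← hh a v, hv, map_zero]
  have hrange : LinearMap.range h = ⊤ := by
    refine (hτ.2 (LinearMap.range h) ?_).resolve_left (h0 ∘ LinearMap.range_eq_bot.1)
    rintro a _ ⟨u, rfl⟩
    exact ⟨ρ a u, (hh a u).symm⟩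
  exact hne ⟨LinearEquiv.ofBijective h
    ⟨LinearMap.ker_eq_bot.1 hker, LinearMap.range_eq_top.1 hrange⟩, fun a v => (hh a v).symm⟩

/-- The trace of a complex module over a real algebra, as a real linear functional. -/
def moduleTrace (ρ : A →ₐ[ℝ] Module.End ℂ S) : A →ₗ[ℝ] ℂ :=
  (LinearMap.trace ℂ S).restrictScalars ℝ ∘ₗ ρ.toLinearMap

theorem moduleTrace_apply (ρ : A →ₐ[ℝ] Module.End ℂ S) (a : A) :
    moduleTrace ρ a = LinearMap.trace ℂ S (ρ a) := rfl

theorem moduleTrace_one [FiniteDimensional ℂ S] (ρ : A →ₐ[ℝ] Module.End ℂ S) :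
    moduleTrace ρ 1 = Module.finrank ℂ S := by
  rw [moduleTrace_apply, map_one, LinearMap.trace_one]

theorem moduleTrace_mul_comm (ρ : A →ₐ[ℝ] Module.End ℂ S) (u v : A) :
    moduleTrace ρ (u * v) = moduleTrace ρ (v * u) := by
  simp only [moduleTrace_apply, map_mul]
  exact LinearMap.trace_mul_comm ℂ _ _

/-- The trace of the virtual module `ρ - τ`; for the two spin modules its restriction to `W̃'` is
the character `S⁺ - S⁻`. -/
def traceDiff (ρ : A →ₐ[ℝ] Module.End ℂ S) (τ : A →ₐ[ℝ] Module.End ℂ T) : A →ₗ[ℝ] ℂ :=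
  moduleTrace ρ - moduleTrace τ

theorem traceDiff_apply (ρ : A →ₐ[ℝ] Module.End ℂ S) (τ : A →ₐ[ℝ] Module.End ℂ T) (a : A) :
    traceDiff ρ τ a = moduleTrace ρ a - moduleTrace τ a := rfl

theorem traceDiff_mul_comm (ρ : A →ₐ[ℝ] Module.End ℂ S) (τ : A →ₐ[ℝ] Module.End ℂ T) (u v : A) :
    traceDiff ρ τ (u * v) = traceDiff ρ τ (v * u) := by
  rw [traceDiff_apply, traceDiff_apply, moduleTrace_mul_comm ρ, moduleTrace_mul_comm τ]

/-- The representation of the unit group on a module. -/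
def unitsRep (ρ : A →ₐ[ℝ] Module.End ℂ S) : Representation ℂ Aˣ S :=
  (ρ : A →* Module.End ℂ S).comp (Units.coeHom A)

theorem unitsRep_apply (ρ : A →ₐ[ℝ] Module.End ℂ S) (u : Aˣ) : unitsRep ρ u = ρ u := rfl

theorem linHom_unitsRep_neg (ρ : A →ₐ[ℝ] Module.End ℂ S) (τ : A →ₐ[ℝ] Module.End ℂ T) (u : Aˣ) :
    (unitsRep ρ).linHom (unitsRep τ) (-u) = (unitsRep ρ).linHom (unitsRep τ) u := by
  ext h v
  simp [Representation.linHom_apply, unitsRep_apply]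

theorem linHom_unitsRep_eq_self_iff (ρ : A →ₐ[ℝ] Module.End ℂ S) (τ : A →ₐ[ℝ] Module.End ℂ T)
    (u : Aˣ) (h : S →ₗ[ℂ] T) :
    (unitsRep ρ).linHom (unitsRep τ) u h = h ↔ ∀ v, τ u (h v) = h (ρ u v) := by
  constructor
  · intro hh v
    conv_rhs => rw [← hh]
    simp [Representation.linHom_apply, unitsRep_apply, ← Module.End.mul_apply, ← map_mul]
  · intro hh
    ext v
    simp [Representation.linHom_apply, unitsRep_apply, hh, ← Module.End.mul_apply, ← map_mul]

theorem trace_linHom_unitsRep [FiniteDimensional ℂ S] [FiniteDimensional ℂ T]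
    (ρ : A →ₐ[ℝ] Module.End ℂ S) (τ : A →ₐ[ℝ] Module.End ℂ T) (u : Aˣ) :
    LinearMap.trace ℂ _ ((unitsRep ρ).linHom (unitsRep τ) u) =
      moduleTrace ρ (u⁻¹ : Aˣ) * moduleTrace τ u :=
  Representation.char_linHom (unitsRep ρ) (unitsRep τ) u

end Schur

section CommutingInvolutions

theorem ofFn_one_add_prod {R : Type*} [Ring R] {m : ℕ} (c : Fin m → R) :
    (List.ofFn fun i => 1 + c i).prod = ∑ I, word c I := by
  induction m with
  | zero => simp [word]
  | succ m ih =>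
    rw [List.ofFn_succ, List.prod_cons, ih, ← (Fin.consEquiv fun _ => Bool).sum_comp,
      Fintype.sum_prod_type]
    simp [word_succ, Fin.consEquiv, add_mul, Finset.mul_sum, add_comm, Fin.tail_def,
      Finset.sum_add_distrib]

theorem mul_ofFn_one_add_prod {R : Type*} [Ring R] {m : ℕ} {c : Fin m → R}
    (hc : ∀ i j, Commute (c i) (c j)) {i : Fin m} (hi : c i * c i = 1) :
    c i * (List.ofFn fun j => 1 + c j).prod = (List.ofFn fun j => 1 + c j).prod := by
  induction m with
  | zero => exact i.elim0
  | succ m ih =>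
    rw [List.ofFn_succ, List.prod_cons, ← mul_assoc]
    cases i using Fin.cases with
    | zero => rw [mul_add, mul_one, hi, add_comm]
    | succ j =>
      rw [((Commute.one_right _).add_right (hc j.succ 0)).eq, mul_assoc,
        ih (c := fun j => c j.succ) (fun i j => hc i.succ j.succ) hi]

variable {k V : Type*} [Field k] [AddCommGroup V] [Module k V] {m : ℕ}
  {c : Fin m → Module.End k V}

theorem ofFn_one_add_prod_apply {s : Fin m → k} {v : V} (hv : ∀ i, c i v = s i • v) :
    (List.ofFn fun i => 1 + c i).prod v = (∏ i, (1 + s i)) • v := by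
  induction m with
  | zero => simp
  | succ m ih =>
    rw [List.ofFn_succ, List.prod_cons, Module.End.mul_apply,
      ih (c := fun i => c i.succ) fun i => hv i.succ, map_smul, LinearMap.add_apply,
      Module.End.one_apply, hv, Fin.prod_univ_succ, mul_comm, mul_smul, add_smul, one_smul]

theorem isProj_ofFn_one_add_prod [NeZero (2 : k)] {p : Submodule k V}
    (hp : ∀ v, v ∈ p ↔ ∀ i, c i v = v) (hc : ∀ i j, Commute (c i) (c j))
    (hsq : ∀ i, c i * c i = 1) :
    LinearMap.IsProj p (((2 : k) ^ m)⁻¹ • (List.ofFn fun i => 1 + c i).prod) where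
  map_mem v := p.smul_mem _ <| (hp _).2 fun i => by
    rw [← Module.End.mul_apply, mul_ofFn_one_add_prod hc (hsq i)]
  map_id v hv := by
    have hfix i : c i v = (1 : k) • v := by rw [(hp v).1 hv i, one_smul]
    rw [LinearMap.smul_apply, ofFn_one_add_prod_apply hfix, smul_smul]
    simp [one_add_one_eq_two, inv_mul_cancel₀ (pow_ne_zero m (two_ne_zero (α := k)))]

end CommutingInvolutions

section SimpleModules

theorem map_word {A B F : Type*} [Monoid A] [Monoid B] [FunLike F A B] [MonoidHomClass F A B]
    (g : F) {m : ℕ} (f : Fin m → A) (I : Fin m → Bool) :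
    g (word f I) = word (fun i => g (f i)) I := by
  rw [word, map_list_prod, List.map_ofFn, word]
  congr 2
  funext i
  cases h : I i <;> simp [h]

/-- The units underlying a Clifford family. -/
def IsCliffordFamily.unit {A : Type*} [Ring A] {m : ℕ} {f : Fin m → A} (hf : IsCliffordFamily f)
    (i : Fin m) : Aˣ where
  val := f i
  inv := -f i
  val_inv := by rw [mul_neg, hf.sq, neg_neg]
  inv_val := by rw [neg_mul, hf.sq, neg_neg]

namespace IsCliffordSystem

variable {A : Type*} [Ring A] [Algebra ℝ A] {m : ℕ} {f : Fin m → A}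
  {S T : Type*} [AddCommGroup S] [Module ℂ S] [AddCommGroup T] [Module ℂ T]
  {ρ : A →ₐ[ℝ] Module.End ℂ S} {τ : A →ₐ[ℝ] Module.End ℂ T}

theorem mem_intertwiners_iff (hf : IsCliffordSystem ℝ f) (h : S →ₗ[ℂ] T) :
    h ∈ intertwiners ρ τ ↔ ∀ i, (unitsRep ρ).linHom (unitsRep τ) (hf.unit i) h = h := by
  simp_rw [linHom_unitsRep_eq_self_iff]
  refine ⟨fun hh i => hh _, fun hh a => ?_⟩
  have ha : a ∈ Algebra.adjoin ℝ (Set.range f) := hf.adjoin_eq_top ▸ Algebra.mem_top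
  induction ha using Algebra.adjoin_induction with
  | mem x hx =>
    obtain ⟨i, rfl⟩ := hx
    exact hh i
  | algebraMap r => simp [Algebra.algebraMap_eq_smul_one]
  | add a b _ _ ha hb => simp [ha, hb]
  | mul a b _ _ ha hb => simp [ha, hb]

variable (ρ τ) in
theorem isProj_intertwiners (hf : IsCliffordSystem ℝ f) :
    LinearMap.IsProj (intertwiners ρ τ) (((2 : ℂ) ^ m)⁻¹ •
      (List.ofFn fun i => 1 + (unitsRep ρ).linHom (unitsRep τ) (hf.unit i)).prod) := by
  refine isProj_ofFn_one_add_prod hf.mem_intertwiners_iff (fun i j => ?_) fun i => ?_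
  · rcases eq_or_ne i j with rfl | hij
    · exact Commute.refl _
    have hanti : hf.unit i * hf.unit j = -(hf.unit j * hf.unit i) := Units.ext (hf.anti i j hij)
    rw [Commute, SemiconjBy, ← map_mul, hanti, linHom_unitsRep_neg, map_mul]
  · have hsq : hf.unit i * hf.unit i = -1 := Units.ext (hf.sq i)
    rw [← map_mul, hsq, linHom_unitsRep_neg, map_one]

variable [FiniteDimensional ℂ S] [FiniteDimensional ℂ T]

variable (ρ τ) in
theorem two_pow_mul_finrank_intertwiners (hf : IsCliffordSystem ℝ f) (hm : 0 < m) {η : ℝ}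
    (hη : η * η = 1) (hφ : (List.ofFn f).prod * (List.ofFn f).prod = algebraMap ℝ A η) :
    (2 : ℂ) ^ m * Module.finrank ℂ (intertwiners ρ τ) =
      Module.finrank ℂ S * Module.finrank ℂ T +
        η * (moduleTrace ρ (List.ofFn f).prod * moduleTrace τ (List.ofFn f).prod) := by
  have hcoe (I) : ((word hf.unit I : Aˣ) : A) = word f I := map_word (Units.coeHom A) hf.unit I
  have hne : (fun _ : Fin m => false) ≠ fun _ => true := fun h => by
    simpa using congrFun h ⟨0, hm⟩
  have hinv : (((word hf.unit fun _ => true)⁻¹ : Aˣ) : A) = η • (List.ofFn f).prod := by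
    rw [← mul_one (((word hf.unit fun _ => true)⁻¹ : Aˣ) : A), Units.inv_mul_eq_iff_eq_mul, hcoe,
      word_true, mul_smul_comm, hφ, Algebra.algebraMap_eq_smul_one, smul_smul, hη, one_smul]
  rw [← (hf.isProj_intertwiners ρ τ).trace, map_smul, smul_eq_mul,
    mul_inv_cancel_left₀ (pow_ne_zero _ two_ne_zero), ofFn_one_add_prod, map_sum]
  simp_rw [← map_word ((unitsRep ρ).linHom (unitsRep τ)), trace_linHom_unitsRep, hcoe]
  rw [Fintype.sum_eq_add _ _ hne fun I hI => by
    rw [hf.map_word_eq_zero_of_tracial (moduleTrace_mul_comm τ) hI.1 hI.2, mul_zero]]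
  rw [hinv, word_true, word_false, word_false, inv_one, Units.val_one, moduleTrace_one,
    moduleTrace_one, map_smul, smul_mul_assoc, Complex.real_smul]

theorem moduleTrace_ofFn_prod_sq (hf : IsCliffordSystem ℝ f) (hm : Odd m)
    (hρ : IsSimpleModuleHom ρ) {η : ℝ}
    (hφ : (List.ofFn f).prod * (List.ofFn f).prod = algebraMap ℝ A η) :
    moduleTrace ρ (List.ofFn f).prod ^ 2 = η * (Module.finrank ℂ S : ℂ) ^ 2 := by
  have := hρ.1
  obtain ⟨z, hz⟩ := exists_eq_smul_one_of_mem_intertwiners (h := ρ (List.ofFn f).prod) hρ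
    fun a v => by
      rw [← Module.End.mul_apply, ← map_mul, ← (hf.commute_ofFn_prod hm a).eq, map_mul,
        Module.End.mul_apply]
  have hzz : z * z = η := by
    have h : (z * z) • (1 : Module.End ℂ S) = (η : ℂ) • 1 := by
      simpa [hz, smul_smul, Algebra.algebraMap_eq_smul_one] using congrArg ρ hφ
    exact smul_left_injective ℂ one_ne_zero h
  rw [moduleTrace_apply, hz, map_smul, LinearMap.trace_one, smul_eq_mul, mul_pow, pow_two z, hzz]

theorem two_mul_finrank_sq (hf : IsCliffordSystem ℝ f) (hm : Odd m)
    (hρ : IsSimpleModuleHom ρ) : 2 * Module.finrank ℂ S ^ 2 = 2 ^ m := by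
  obtain ⟨η, hη, hφ⟩ := hf.exists_ofFn_prod_mul_self ℝ
  have hη' : (η : ℂ) * η = 1 := by exact_mod_cast hη
  have hdim := hf.two_pow_mul_finrank_intertwiners ρ ρ hm.pos hη hφ
  rw [finrank_intertwiners_self hρ, ← pow_two (moduleTrace ρ _),
    hf.moduleTrace_ofFn_prod_sq hm hρ hφ] at hdim
  have : (2 * Module.finrank ℂ S ^ 2 : ℂ) = 2 ^ m := by
    linear_combination -hdim - (Module.finrank ℂ S : ℂ) ^ 2 * hη'
  exact_mod_cast this

variable (ρ τ) in
theorem traceDiff_one (hf : IsCliffordSystem ℝ f) (hm : Odd m) (hρ : IsSimpleModuleHom ρ)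
    (hτ : IsSimpleModuleHom τ) : traceDiff ρ τ 1 = 0 := by
  have hdim : Module.finrank ℂ S ^ 2 = Module.finrank ℂ T ^ 2 :=
    Nat.eq_of_mul_eq_mul_left two_pos
      ((hf.two_mul_finrank_sq hm hρ).trans (hf.two_mul_finrank_sq hm hτ).symm)
  rw [traceDiff_apply, moduleTrace_one, moduleTrace_one,
    Nat.pow_left_injective two_ne_zero hdim, sub_self]

theorem traceDiff_ofFn_prod_sq (hf : IsCliffordSystem ℝ f) (hm : Odd m)
    (hρ : IsSimpleModuleHom ρ) (hτ : IsSimpleModuleHom τ) (hne : ¬ AreIsomorphic ρ τ) {η : ℝ}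
    (hη : η * η = 1) (hφ : (List.ofFn f).prod * (List.ofFn f).prod = algebraMap ℝ A η) :
    traceDiff ρ τ (List.ofFn f).prod ^ 2 = 2 ^ (m + 1) * η := by
  have hη' : (η : ℂ) * η = 1 := by exact_mod_cast hη
  have hS := hf.moduleTrace_ofFn_prod_sq hm hρ hφ
  have hT := hf.moduleTrace_ofFn_prod_sq hm hτ hφ
  have hdim : (Module.finrank ℂ S : ℂ) = Module.finrank ℂ T := by
    simpa [traceDiff_apply, moduleTrace_one, sub_eq_zero] using hf.traceDiff_one ρ τ hm hρ hτ
  have htwo : (2 * Module.finrank ℂ T ^ 2 : ℂ) = 2 ^ m := by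
    exact_mod_cast hf.two_mul_finrank_sq hm hτ
  have hprod := hf.two_pow_mul_finrank_intertwiners ρ τ hm.pos hη hφ
  rw [intertwiners_eq_bot hρ hτ hne, finrank_bot, Nat.cast_zero, mul_zero] at hprod
  rw [hdim] at hS hprod
  rw [traceDiff_apply]
  linear_combination hS + hT + 2 * η * hprod + 2 * η * htwo +
    2 * moduleTrace ρ (List.ofFn f).prod * moduleTrace τ (List.ofFn f).prod * hη'

theorem traceDiff_map_eq_neg (hf : IsCliffordSystem ℝ f) (hm : Odd m)
    (hρ : IsSimpleModuleHom ρ) (hτ : IsSimpleModuleHom τ) (F : A →ₐ[ℝ] A)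
    (hF : F (List.ofFn f).prod = -(List.ofFn f).prod) (x : A) :
    traceDiff ρ τ (F x) = -traceDiff ρ τ x := by
  have hone := hf.traceDiff_one ρ τ hm hρ hτ
  refine LinearMap.congr_fun (hf.tracial_ext (T := traceDiff ρ τ ∘ₗ F.toLinearMap)
    (U := -traceDiff ρ τ) (fun u v => ?_) (fun u v => ?_) ?_ ?_) x
  · simp [traceDiff_mul_comm ρ τ (F u)]
  · simp [traceDiff_mul_comm ρ τ u]
  · simp [hone]
  · simp [hF]

end IsCliffordSystem

end SimpleModules

/-! ### Diagonalisable endomorphisms -/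

section Diagonalizable

section Field

variable {k V κ : Type*} [Field k] [AddCommGroup V] [Module k V]

theorem map_eq_smul_of_mul_eq_one {f g : Module.End k V} (hgf : g * f = 1) {μ ν : k}
    (hνμ : ν * μ = 1) {v : V} (hv : f v = μ • v) : g v = ν • v := by
  calc g v = (ν * μ) • g v := by rw [hνμ, one_smul]
    _ = ν • (g * f) v := by rw [Module.End.mul_apply, hv, map_smul, mul_smul]
    _ = ν • v := by rw [hgf, Module.End.one_apply]

variable [Fintype κ] (b : Module.Basis κ k V) {f : Module.End k V} {μ : κ → k}
  (h : ∀ i, f (b i) = μ i • b i)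

include h

theorem toMatrix_eq_diagonal [DecidableEq κ] : LinearMap.toMatrix b b f = Matrix.diagonal μ := by
  ext i j
  rcases eq_or_ne i j with rfl | hij
  · simp [LinearMap.toMatrix_apply, h]
  · simp [LinearMap.toMatrix_apply, h, hij]

theorem trace_eq_sum_of_basis : LinearMap.trace k V f = ∑ i, μ i := by
  classical
  rw [LinearMap.trace_eq_matrix_trace k b, toMatrix_eq_diagonal b h, Matrix.trace_diagonal]

theorem det_eq_prod_of_basis : LinearMap.det f = ∏ i, μ i := by
  classical
  rw [← LinearMap.det_toMatrix b, toMatrix_eq_diagonal b h, Matrix.det_diagonal]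

end Field

theorem exists_eigenbasis_of_isOfFinOrder {V : Type*} [AddCommGroup V] [Module ℂ V]
    [FiniteDimensional ℂ V] {f : Module.End ℂ V} (hf : IsOfFinOrder f) :
    ∃ (b : Module.Basis (Fin (Module.finrank ℂ V)) ℂ V) (μ : Fin (Module.finrank ℂ V) → ℂ),
      (∀ i, f (b i) = μ i • b i) ∧ ∀ i, starRingEnd ℂ (μ i) * μ i = 1 := by
  classical
  obtain ⟨n, hn, hfn⟩ := hf.exists_pow_eq_one
  have hs : f.IsSemisimple := Module.End.isSemisimple_of_squarefree_aeval_eq_zero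
    (Polynomial.separable_X_pow_sub_C (1 : ℂ) (Nat.cast_ne_zero.2 hn.ne') one_ne_zero).squarefree
    (by simp [hfn])
  have hI := DirectSum.isInternal_submodule_of_iSupIndep_of_iSup_eq_top
    f.eigenspaces_iSupIndep hs.iSup_eigenspace_eq_top
  let b := hI.collectedBasis fun μ => Module.finBasis ℂ (f.eigenspace μ)
  let e := b.indexEquiv (Module.finBasis ℂ V)
  have hb i : f.HasEigenvector i.1 (b i) := ⟨hI.collectedBasis_mem _ i, b.ne_zero i⟩
  have hpow (i : Σ μ : ℂ, Fin (Module.finrank ℂ (f.eigenspace μ))) : i.1 ^ n = 1 := by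
    refine smul_left_injective ℂ (b.ne_zero i) ?_
    simpa [hfn] using ((hb i).pow_apply n).symm
  refine ⟨b.reindex e, fun i => (e.symm i).1, fun i => by simp [(hb _).apply_eq_smul], fun i => ?_⟩
  rw [mul_comm, Complex.mul_conj, Complex.normSq_eq_norm_sq,
    Complex.norm_eq_one_of_pow_eq_one (hpow (e.symm i)) hn.ne', one_pow, Complex.ofReal_one]

theorem isOfFinOrder_baseChange {E : Type*} [AddCommGroup E] [Module ℝ E] {u : Module.End ℝ E}
    (hu : IsOfFinOrder u) : IsOfFinOrder (u.baseChange ℂ) :=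
  (Module.End.baseChangeHom ℝ ℂ E).toMonoidHom.isOfFinOrder hu

end Diagonalizable

/-! ### Traces of endomorphisms of a Clifford algebra -/

section CliffordTrace

section Field

variable {k V : Type*} [Field k] [AddCommGroup V] [Module k V] (Q : QuadraticForm k V) {m : ℕ}
  (b : Module.Basis (Fin m) k V)

theorem span_word_ι :
    Submodule.span k (Set.range (word fun i => CliffordAlgebra.ι Q (b i))) = ⊤ := by
  refine span_word_eq_top (fun i => ⟨_, (CliffordAlgebra.ι_sq_scalar Q _).symm⟩)
    (fun i j => ⟨_, (CliffordAlgebra.ι_mul_ι_add_swap _ _).symm⟩) ?_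
  have hrange : Set.range (CliffordAlgebra.ι Q) =
      Submodule.span k (Set.range fun i => CliffordAlgebra.ι Q (b i)) := by
    rw [← LinearMap.coe_range, LinearMap.range_eq_map, ← b.span_eq, Submodule.map_span,
      ← Set.range_comp]
    rfl
  rw [← Algebra.adjoin_span, ← hrange, CliffordAlgebra.adjoin_range_ι]

variable [Invertible (2 : k)]

include b in
theorem finrank_cliffordAlgebra : Module.finrank k (CliffordAlgebra Q) = 2 ^ m := by
  rw [Module.finrank_eq_card_basis (b.ExteriorAlgebra.map
    (CliffordAlgebra.equivExterior Q).symm)]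
  simp

/-- The words in a basis of `V` form a basis of the Clifford algebra. -/
def wordBasis : Module.Basis (Fin m → Bool) k (CliffordAlgebra Q) :=
  basisOfTopLeSpanOfCardEqFinrank (word fun i => CliffordAlgebra.ι Q (b i)) (span_word_ι Q b).ge
    (by simp [finrank_cliffordAlgebra Q b])

theorem wordBasis_apply (I : Fin m → Bool) :
    wordBasis Q b I = word (fun i => CliffordAlgebra.ι Q (b i)) I :=
  congrFun (coe_basisOfTopLeSpanOfCardEqFinrank _ _ _) I

variable {Q} in
theorem trace_eq_prod_one_add {Ψ : CliffordAlgebra Q →ₐ[k] CliffordAlgebra Q} {μ : Fin m → k}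
    (h : ∀ i, Ψ (CliffordAlgebra.ι Q (b i)) = μ i • CliffordAlgebra.ι Q (b i)) :
    LinearMap.trace k (CliffordAlgebra Q) Ψ.toLinearMap = ∏ i, (1 + μ i) := by
  have hsum i : 1 + μ i = ∑ c : Bool, if c then μ i else 1 := by simp [add_comm]
  rw [trace_eq_sum_of_basis (wordBasis Q b) (μ := fun I => ∏ i, if I i then μ i else 1) fun I => by
    rw [wordBasis_apply]; exact map_word_of_map_eq_smul Ψ h I]
  simp_rw [hsum]
  rw [Finset.prod_univ_sum, Fintype.piFinset_univ]

end Field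

variable {E : Type*} [AddCommGroup E] [Module ℝ E] [FiniteDimensional ℝ E] (Q : QuadraticForm ℝ E)

instance finite_cliffordAlgebra : Module.Finite ℝ (CliffordAlgebra Q) :=
  Module.Finite.of_basis (wordBasis Q (Module.finBasis ℝ E))

variable {Q} in
theorem trace_eq_det_one_add {Ψ : CliffordAlgebra Q →ₐ[ℝ] CliffordAlgebra Q} {u : Module.End ℝ E}
    (hΨ : ∀ x, Ψ (CliffordAlgebra.ι Q x) = CliffordAlgebra.ι Q (u x)) (hu : IsOfFinOrder u) :
    LinearMap.trace ℝ (CliffordAlgebra Q) Ψ.toLinearMap = LinearMap.det (1 + u) := by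
  obtain ⟨b, μ, hb, -⟩ := exists_eigenbasis_of_isOfFinOrder (isOfFinOrder_baseChange hu)
  let e := CliffordAlgebra.equivBaseChange ℂ Q
  let Ψ' : CliffordAlgebra (Q.baseChange ℂ) →ₐ[ℂ] CliffordAlgebra (Q.baseChange ℂ) :=
    (e.symm : _ →ₐ[ℂ] _).comp ((Algebra.TensorProduct.map (AlgHom.id ℂ ℂ) Ψ).comp e)
  have hι x : Ψ' (CliffordAlgebra.ι _ x) = CliffordAlgebra.ι _ (u.baseChange ℂ x) := by
    induction x with
    | zero => simp
    | add x y hx hy => simp only [map_add, hx, hy]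
    | tmul z x => simp [Ψ', e, CliffordAlgebra.equivBaseChange, hΨ]
  have htrace := trace_eq_prod_one_add b (Ψ := Ψ') (μ := μ) fun i => by
    rw [hι, ← map_smul, ← hb]
  have hconj : Ψ'.toLinearMap = e.toLinearEquiv.symm.conj (Ψ.toLinearMap.baseChange ℂ) := rfl
  rw [hconj, LinearMap.trace_conj', LinearMap.trace_baseChange] at htrace
  have hdet : LinearMap.det ((1 + u).baseChange ℂ) = ∏ i, (1 + μ i) := by
    refine det_eq_prod_of_basis b fun i => ?_
    rw [LinearMap.baseChange_add, LinearMap.baseChange_one, LinearMap.add_apply, add_smul, ← hb,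
      Module.End.one_apply, one_smul]
  rw [LinearMap.det_baseChange] at hdet
  exact (algebraMap ℝ ℂ).injective (htrace.trans hdet.symm)

end CliffordTrace

/-! ### Graded traces on symmetric powers -/

section SymTrace

variable {k V κ : Type*} [Field k] [AddCommGroup V] [Module k V] (b : Module.Basis κ k V)

theorem symPow_eq_map_homogeneousSubmodule (i : ℕ) :
    symPow k V i = (MvPolynomial.homogeneousSubmodule κ k i).map
      (SymmetricAlgebra.equivMvPolynomial b).symm.toLinearMap := by
  rw [symPow, ← MvPolynomial.homogeneousSubmodule_one_pow,
    MvPolynomial.homogeneousSubmodule_one_eq_span_X]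
  change _ = Submodule.map (SymmetricAlgebra.equivMvPolynomial b).symm.toAlgHom.toLinearMap _
  rw [Submodule.map_pow, Submodule.map_span, ← Set.range_comp, LinearMap.range_eq_map, ← b.span_eq,
    Submodule.map_span, ← Set.range_comp]
  congr 3
  ext j
  simp

theorem symPow_eq_span (i : ℕ) :
    symPow k V i = Submodule.span k (b.symmetricAlgebra '' {m | m.degree = i}) := by
  rw [symPow_eq_map_homogeneousSubmodule b, MvPolynomial.homogeneousSubmodule_eq_finsupp_supported,
    AddMonoidAlgebra.supported_eq_span_single, Submodule.map_span, ← Set.image_comp]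
  congr 2

variable [Fintype κ]

theorem symmetricAlgebra_basis_apply (m : κ →₀ ℕ) :
    b.symmetricAlgebra m = ∏ i, SymmetricAlgebra.ι k V (b i) ^ m i := by
  rw [Module.Basis.symmetricAlgebra, Module.Basis.map_apply, MvPolynomial.coe_basisMonomials]
  simp [MvPolynomial.monomial_eq, Finsupp.prod_fintype]

variable {f : V →ₗ[k] V} {μ : κ → k} (h : ∀ j, f (b j) = μ j • b j)

include h

theorem symMap_symmetricAlgebra_basis (m : κ →₀ ℕ) :
    symMap f (b.symmetricAlgebra m) = (∏ j, μ j ^ m j) • b.symmetricAlgebra m := by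
  simp [symmetricAlgebra_basis_apply, symMap, h, smul_pow, Finset.prod_smul]

theorem trace_symPowMap [DecidableEq κ] (i : ℕ) :
    LinearMap.trace k _ (symPowMap f i) =
      ∑ m ∈ Finset.finsuppAntidiag Finset.univ i, ∏ j, μ j ^ m j := by
  let s : Finset (κ →₀ ℕ) := Finset.finsuppAntidiag Finset.univ i
  have hs : (s : Set (κ →₀ ℕ)) = {m | m.degree = i} := by
    ext m
    simp [s, Finset.mem_finsuppAntidiag, Finsupp.degree_eq_sum]
  have hspan : Submodule.span k (Set.range fun m : s => b.symmetricAlgebra m.1) = symPow k V i := by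
    rw [symPow_eq_span b, ← hs, Set.image_eq_range]
    rfl
  let c : Module.Basis s k (symPow k V i) :=
    (Module.Basis.span (b.symmetricAlgebra.linearIndependent.comp _ Subtype.val_injective)).map
      (LinearEquiv.ofEq _ _ hspan)
  have hc (m : s) : (c m : SymmetricAlgebra k V) = b.symmetricAlgebra m.1 := by
    simp [c, Module.Basis.span_apply]
  rw [trace_eq_sum_of_basis c (μ := fun m => ∏ j, μ j ^ m.1 j), Finset.sum_coe_sort s
    fun m => ∏ j, μ j ^ m j]
  refine fun m => Subtype.ext ?_
  rw [Submodule.coe_smul, hc, ← symMap_symmetricAlgebra_basis b h, ← hc]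
  rfl

theorem mk_trace_symPowMap_mul :
    (PowerSeries.mk fun i => LinearMap.trace k _ (symPowMap f i)) *
      ∏ j, (1 - PowerSeries.C (μ j) * PowerSeries.X) = 1 := by
  classical
  have hmk : (PowerSeries.mk fun i => LinearMap.trace k _ (symPowMap f i)) =
      ∏ j, PowerSeries.mk fun n => μ j ^ n := by
    ext i
    rw [PowerSeries.coeff_prod, PowerSeries.coeff_mk, trace_symPowMap b h]
    simp
  rw [hmk, ← Finset.prod_mul_distrib]
  refine Finset.prod_eq_one fun j _ => ?_
  simpa [PowerSeries.rescale_mk, PowerSeries.rescale_X] using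
    congrArg (PowerSeries.rescale (μ j)) (PowerSeries.mk_one_mul_one_sub_eq_one k)

end SymTrace

section DetOneSub

variable {E : Type*} [AddCommGroup E] [Module ℝ E]

theorem isOfFinOrder_toLinearMap {w : E ≃ₗ[ℝ] E} (hw : IsOfFinOrder w) :
    IsOfFinOrder (w : Module.End ℝ E) :=
  (LinearEquiv.automorphismGroup.toLinearMapMonoidHom (R := ℝ) (M := E)).isOfFinOrder hw

variable [FiniteDimensional ℝ E]

theorem detOneSubX_eq_prod {κ : Type*} [Fintype κ] (w : E ≃ₗ[ℝ] E)
    (b : Module.Basis κ ℂ (ℂ ⊗[ℝ] E)) {μ : κ → ℂ}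
    (h : ∀ j, (w : E →ₗ[ℝ] E).baseChange ℂ (b j) = μ j • b j) :
    detOneSubX w = ∏ j, (1 - Polynomial.C (μ j) * Polynomial.X) := by
  classical
  have hmap {n : ℕ} (A : Matrix (Fin n) (Fin n) ℝ) :
      A.charpolyRev.map (algebraMap ℝ ℂ) = (A.map (algebraMap ℝ ℂ)).charpolyRev := by
    rw [Matrix.charpolyRev, Matrix.charpolyRev, ← Polynomial.coe_mapRingHom, RingHom.map_det]
    congr 1
    ext i j : 2
    simp only [RingHom.mapMatrix_apply, Matrix.map_apply, Matrix.sub_apply, Matrix.smul_apply]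
    rcases eq_or_ne i j with rfl | hij
    · simp
    · simp [hij]
  rw [detOneSubX, hmap, ← LinearMap.toMatrix_baseChange, ← Matrix.reverse_charpoly,
    LinearMap.charpoly_toMatrix, ← LinearMap.charpoly_toMatrix _ b, Matrix.reverse_charpoly,
    toMatrix_eq_diagonal b h, Matrix.charpolyRev, ← Matrix.det_diagonal]
  congr 1
  ext i j : 2
  rcases eq_or_ne i j with rfl | hij
  · simp [Polynomial.X_mul_C]
  · simp [hij]

theorem mk_trace_symPow_mul_detOneSubX {w : E ≃ₗ[ℝ] E} (hw : IsOfFinOrder w) :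
    (PowerSeries.mk fun i => LinearMap.trace ℂ _
      (symPowMap ((w : E →ₗ[ℝ] E).baseChange ℂ) i)) * (detOneSubX w : ℂ⟦X⟧) = 1 := by
  obtain ⟨b, μ, hb, -⟩ := exists_eigenbasis_of_isOfFinOrder
    (isOfFinOrder_baseChange (isOfFinOrder_toLinearMap hw))
  rw [detOneSubX_eq_prod w b hb, ← mk_trace_symPowMap_mul b hb,
    ← Polynomial.coeToPowerSeries.ringHom_apply, map_prod]
  simp

theorem detOneSubX_inv {w : E ≃ₗ[ℝ] E} (hw : IsOfFinOrder w) :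
    detOneSubX w⁻¹ = detOneSubX w := by
  obtain ⟨b, μ, hb, hμ⟩ := exists_eigenbasis_of_isOfFinOrder
    (isOfFinOrder_baseChange (isOfFinOrder_toLinearMap hw))
  have hinv : ((w⁻¹ : E ≃ₗ[ℝ] E) : Module.End ℝ E).baseChange ℂ *
      (w : Module.End ℝ E).baseChange ℂ = 1 := by
    rw [← LinearMap.baseChange_mul, ← LinearEquiv.automorphismGroup.toLinearMapMonoidHom_apply,
      ← LinearEquiv.automorphismGroup.toLinearMapMonoidHom_apply, ← map_mul, inv_mul_cancel,
      map_one, LinearMap.baseChange_one]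
  have hreal : (detOneSubX w).map (starRingEnd ℂ) = detOneSubX w := by
    rw [detOneSubX, Polynomial.map_map]
    congr 1
    ext x
    simp
  rw [detOneSubX_eq_prod _ b fun j => map_eq_smul_of_mul_eq_one hinv (hμ j) (hb j), ← hreal,
    detOneSubX_eq_prod _ b hb, Polynomial.map_prod]
  simp

end DetOneSub

/-! ### Orthogonal parts of virtual characters -/

section CharacterTheory

/-- `χ` is the character of a representation of `G` in which the elements of `Z` act by `-1`. With
`Z = ∅` this is the notion of a character, with `Z = {-1} ⊆ W̃'` that of a genuine one. -/
def IsCharacterOn {G : Type*} [Group G] (Z : Set G) (χ : G → ℂ) : Prop :=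
  ∃ (n : ℕ) (ρ : Representation ℂ G (Fin n → ℂ)), (∀ z ∈ Z, ρ z = -1) ∧ ρ.character = χ

section Group

variable {G : Type*} [Group G] {Z : Set G}

theorem isCharacter_iff {χ : G → ℂ} : IsCharacter G χ ↔ IsCharacterOn ∅ χ := by
  simp [IsCharacter, IsCharacterOn]

theorem IsCharacterOn.isCharacter {χ : G → ℂ} (h : IsCharacterOn Z χ) : IsCharacter G χ := by
  obtain ⟨n, ρ, -, h⟩ := h
  exact ⟨n, ρ, h⟩

theorem isCharacterOn_character {V : Type*} [AddCommGroup V] [Module ℂ V] [FiniteDimensional ℂ V]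
    {ρ : Representation ℂ G V} (hρ : ∀ z ∈ Z, ρ z = -1) : IsCharacterOn Z ρ.character := by
  let e := (Module.finBasis ℂ V).equivFun
  refine ⟨_, e.conjRingEquiv.toMonoidHom.comp ρ, fun z hz => ?_, ?_⟩
  · ext v
    simp [hρ z hz]
  · ext g
    exact LinearMap.trace_conj' (ρ g) e

theorem IsCharacterOn.exists_apply_one_eq_natCast {χ : G → ℂ} (hχ : IsCharacterOn Z χ) :
    ∃ n : ℕ, χ 1 = n := by
  obtain ⟨n, ρ, -, rfl⟩ := hχ
  exact ⟨_, ρ.char_one⟩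

theorem IsCharacterOn.add {χ ψ : G → ℂ} (hχ : IsCharacterOn Z χ) (hψ : IsCharacterOn Z ψ) :
    IsCharacterOn Z (χ + ψ) := by
  obtain ⟨n, ρ, hρ, rfl⟩ := hχ
  obtain ⟨m, τ, hτ, rfl⟩ := hψ
  have hprod : ρ.character + τ.character = (ρ.prod τ).character := by
    ext g
    exact (LinearMap.trace_prodMap' (ρ g) (τ g)).symm
  rw [hprod]
  refine isCharacterOn_character fun z hz => ?_
  ext v <;> simp [hρ z hz, hτ z hz]

theorem IsCharacterOn.comp {H : Type*} [Group H] {Y : Set H} {χ : G → ℂ} (hχ : IsCharacterOn Z χ)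
    (φ : H →* G) (hφ : ∀ y ∈ Y, φ y ∈ Z) : IsCharacterOn Y (χ ∘ φ) := by
  obtain ⟨n, ρ, hρ, rfl⟩ := hχ
  exact ⟨n, ρ.comp φ, fun y hy => hρ _ (hφ y hy), rfl⟩

theorem IsCharacter.comp_mul {H : Type*} [Group H] {χ : H → ℂ} {ψ : G → ℂ}
    (hχ : IsCharacter H χ) (hψ : IsCharacterOn Z ψ) (φ : G →* H) (hφ : ∀ z ∈ Z, φ z = 1) :
    IsCharacterOn Z fun g => χ (φ g) * ψ g := by
  obtain ⟨n, ρ, rfl⟩ := hχ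
  obtain ⟨m, τ, hτ, rfl⟩ := hψ
  have htensor : (fun g => ρ.character (φ g) * τ.character g) =
      (Representation.tprod (ρ.comp φ) τ).character := by
    rw [Representation.char_tensor]
    rfl
  rw [htensor]
  refine isCharacterOn_character fun z hz => ?_
  rw [Representation.tprod_apply, hτ z hz, MonoidHom.comp_apply, hφ z hz, map_one]
  ext
  simp [TensorProduct.tmul_neg]

theorem IsCharacter.inv {χ : G → ℂ} (hχ : IsCharacter G χ) : IsCharacter G fun g => χ g⁻¹ := by
  obtain ⟨n, ρ, rfl⟩ := hχ
  convert isCharacter_iff.2 (isCharacterOn_character (ρ := ρ.dual) (by simp)) using 1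
  ext g
  rw [Representation.char_dual]

theorem exists_sub_of_mem_virtualCharacters {χ : G → ℂ} (hχ : χ ∈ virtualCharacters G) :
    ∃ a b, IsCharacter G a ∧ IsCharacter G b ∧ χ = a - b := by
  have hzero : IsCharacter G (0 : G → ℂ) := ⟨0, 1, by ext g; simp [Representation.character]⟩
  have hadd {a b : G → ℂ} (ha : IsCharacter G a) (hb : IsCharacter G b) : IsCharacter G (a + b) :=
    isCharacter_iff.2 ((isCharacter_iff.1 ha).add (isCharacter_iff.1 hb))
  induction hχ using AddSubgroup.closure_induction with
  | mem x hx => exact ⟨x, 0, hx, hzero, by simp⟩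
  | zero => exact ⟨0, 0, hzero, hzero, by simp⟩
  | add x y _ _ hx hy =>
    obtain ⟨a, b, ha, hb, rfl⟩ := hx
    obtain ⟨c, d, hc, hd, rfl⟩ := hy
    exact ⟨a + c, b + d, hadd ha hc, hadd hb hd, by abel⟩
  | neg x _ hx =>
    obtain ⟨a, b, ha, hb, rfl⟩ := hx
    exact ⟨b, a, hb, ha, by abel⟩

theorem inv_mem_virtualCharacters {χ : G → ℂ} (hχ : χ ∈ virtualCharacters G) :
    (fun g => χ g⁻¹) ∈ virtualCharacters G := by
  obtain ⟨a, b, ha, hb, rfl⟩ := exists_sub_of_mem_virtualCharacters hχ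
  exact sub_mem (AddSubgroup.subset_closure ha.inv) (AddSubgroup.subset_closure hb.inv)

theorem charPairing_eq_sum [Fintype G] (χ ψ : G → ℂ) :
    charPairing χ ψ = (Nat.card G : ℂ)⁻¹ * ∑ g, χ g * ψ g⁻¹ := by
  rw [charPairing, finsum_eq_sum_of_fintype]

end Group

theorem trace_inv_eq_conj {V : Type*} [AddCommGroup V] [Module ℂ V] [FiniteDimensional ℂ V]
    {f g : Module.End ℂ V} (hgf : g * f = 1) (hf : IsOfFinOrder f) :
    LinearMap.trace ℂ V g = starRingEnd ℂ (LinearMap.trace ℂ V f) := by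
  obtain ⟨b, μ, hb, hμ⟩ := exists_eigenbasis_of_isOfFinOrder hf
  rw [trace_eq_sum_of_basis b fun i => map_eq_smul_of_mul_eq_one hgf (hμ i) (hb i),
    trace_eq_sum_of_basis b hb, map_sum]

section FiniteGroup

variable {G : Type*} [Group G] [Finite G] {Z : Set G}

theorem IsCharacter.inv_apply {χ : G → ℂ} (hχ : IsCharacter G χ) (g : G) :
    χ g⁻¹ = starRingEnd ℂ (χ g) := by
  obtain ⟨n, ρ, rfl⟩ := hχ
  exact trace_inv_eq_conj (by rw [← map_mul, inv_mul_cancel, map_one])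
    (ρ.isOfFinOrder (isOfFinOrder_of_finite g))

theorem inv_apply_of_mem_virtualCharacters {χ : G → ℂ} (hχ : χ ∈ virtualCharacters G) (g : G) :
    χ g⁻¹ = starRingEnd ℂ (χ g) := by
  obtain ⟨a, b, ha, hb, rfl⟩ := exists_sub_of_mem_virtualCharacters hχ
  simp [ha.inv_apply, hb.inv_apply]

theorem charPairing_comm (χ ψ : G → ℂ) : charPairing χ ψ = charPairing ψ χ := by
  have := Fintype.ofFinite G
  rw [charPairing_eq_sum, charPairing_eq_sum, ← Equiv.sum_comp (Equiv.inv G)]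
  simp [mul_comm]

theorem charPairing_sub_left (χ χ' ψ : G → ℂ) :
    charPairing (χ - χ') ψ = charPairing χ ψ - charPairing χ' ψ := by
  have := Fintype.ofFinite G
  simp [charPairing_eq_sum, sub_mul, mul_sub]

theorem charPairing_sub_right (χ ψ ψ' : G → ℂ) :
    charPairing χ (ψ - ψ') = charPairing χ ψ - charPairing χ ψ' := by
  rw [charPairing_comm, charPairing_sub_left, charPairing_comm ψ, charPairing_comm ψ']

theorem charPairing_comp_equiv {H : Type*} [Group H] (e : H ≃* G) (χ ψ : G → ℂ) :
    charPairing (χ ∘ e) (ψ ∘ e) = charPairing χ ψ := by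
  have := Fintype.ofFinite G
  have := Fintype.ofEquiv G e.symm.toEquiv
  rw [charPairing_eq_sum, charPairing_eq_sum, Nat.card_congr e.toEquiv,
    ← Equiv.sum_comp e.toEquiv]
  simp

theorem charPairing_character {V U : Type*} [AddCommGroup V] [Module ℂ V] [FiniteDimensional ℂ V]
    [AddCommGroup U] [Module ℂ U] [FiniteDimensional ℂ U] (ρ : Representation ℂ G V)
    (τ : Representation ℂ G U) : charPairing τ.character ρ.character =
      Module.finrank ℂ (Representation.IntertwiningMap ρ τ) := by
  have := Fintype.ofFinite G
  have : Invertible (Nat.card G : ℂ) := invertibleOfNonzero (by simp)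
  rw [charPairing_eq_sum, Representation.card_inv_mul_sum_char_mul_char_eq_finrank]

theorem exists_charPairing_eq_natCast {χ ψ : G → ℂ} (hχ : IsCharacter G χ)
    (hψ : IsCharacter G ψ) : ∃ n : ℕ, charPairing χ ψ = n := by
  obtain ⟨n, ρ, rfl⟩ := hχ
  obtain ⟨m, τ, rfl⟩ := hψ
  exact ⟨_, charPairing_character τ ρ⟩

theorem charPairing_self [Fintype G] {χ : G → ℂ} (hχ : χ ∈ virtualCharacters G) :
    charPairing χ χ = ((Nat.card G : ℝ)⁻¹ * ∑ g, ‖χ g‖ ^ 2 : ℝ) := by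
  rw [charPairing_eq_sum]
  push_cast
  simp_rw [inv_apply_of_mem_virtualCharacters hχ, Complex.mul_conj']

theorem eq_zero_of_charPairing_self_eq_neg {χ : G → ℂ} (hχ : χ ∈ virtualCharacters G) {n : ℕ}
    (h : charPairing χ χ = -n) : χ = 0 := by
  have := Fintype.ofFinite G
  have hsum : (Nat.card G : ℝ)⁻¹ * ∑ g, ‖χ g‖ ^ 2 = -n := by
    rw [charPairing_self hχ] at h
    exact_mod_cast h
  have hcard : (0 : ℝ) < (Nat.card G : ℝ)⁻¹ := inv_pos.2 (Nat.cast_pos.2 Nat.card_pos)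
  have hnonpos : ∑ g, ‖χ g‖ ^ 2 ≤ 0 :=
    nonpos_of_mul_nonpos_right (hsum.trans_le (neg_nonpos.2 n.cast_nonneg)) hcard
  have hzero := hnonpos.antisymm (Finset.sum_nonneg fun g _ => sq_nonneg ‖χ g‖)
  ext g
  simpa using (Finset.sum_eq_zero_iff_of_nonneg fun g _ => sq_nonneg ‖χ g‖).1 hzero g

theorem orthogonal_parts_unique {a b a' b' : G → ℂ} (ha : IsCharacter G a) (hb : IsCharacter G b)
    (ha' : IsCharacter G a') (hb' : IsCharacter G b') (h : charPairing a b = 0)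
    (h' : charPairing a' b' = 0) (hab : a - b = a' - b') : a = a' ∧ b = b' := by
  have hsub : a - a' = b - b' := by linear_combination hab
  obtain ⟨n, hn⟩ := exists_charPairing_eq_natCast ha hb'
  obtain ⟨m, hm⟩ := exists_charPairing_eq_natCast ha' hb
  have hself : charPairing (a - a') (a - a') = -(n + m : ℕ) := by
    nth_rewrite 2 [hsub]
    rw [charPairing_sub_left, charPairing_sub_right, charPairing_sub_right, h, h', hn, hm]
    push_cast
    ring
  have hzero := eq_zero_of_charPairing_self_eq_neg (sub_mem (AddSubgroup.subset_closure ha)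
    (AddSubgroup.subset_closure ha')) hself
  exact ⟨sub_eq_zero.1 hzero, sub_eq_zero.1 (hsub ▸ hzero)⟩

end FiniteGroup

section Subrepresentation

variable {G V U : Type*} [Group G] [AddCommGroup V] [Module ℂ V] [AddCommGroup U] [Module ℂ U]
  {ρ : Representation ℂ G V} {τ : Representation ℂ G U}

theorem isCompl_toSubmodule {p q : Subrepresentation ρ} (h : IsCompl p q) :
    IsCompl p.toSubmodule q.toSubmodule where
  disjoint := by
    rw [disjoint_iff, ← Subrepresentation.toSubmodule_inf, h.inf_eq_bot]
    rfl
  codisjoint := by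
    rw [codisjoint_iff, ← Subrepresentation.toSubmodule_sup, h.sup_eq_top]
    rfl

theorem toRepresentation_eq_neg_one (p : Subrepresentation ρ) {z : G} (hz : ρ z = -1) :
    p.toRepresentation z = -1 :=
  LinearMap.ext fun v => Subtype.ext (LinearMap.congr_fun hz v)

theorem character_range_eq_of_isCompl_ker (f : Representation.IntertwiningMap ρ τ)
    {c : Subrepresentation ρ} (hc : IsCompl c f.ker) :
    c.toRepresentation.character = f.range.toRepresentation.character :=
  Representation.char_iso <|
    .mk (LinearMap.kerComplementEquivRange f.toLinearMap (isCompl_toSubmodule hc)) fun g =>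
      LinearMap.ext fun x => Subtype.ext (LinearMap.congr_fun (f.isIntertwining' g) x.1)

theorem character_eq_add_of_isCompl [FiniteDimensional ℂ V] {p q : Subrepresentation ρ}
    (h : IsCompl p q) :
    ρ.character = p.toRepresentation.character + q.toRepresentation.character := by
  let e : Representation.Equiv (p.toRepresentation.prod q.toRepresentation) ρ :=
    .mk (Submodule.prodEquivOfIsCompl _ _ (isCompl_toSubmodule h)) fun g => by
      ext x <;> simp <;> rfl
  rw [← Representation.char_iso e]
  ext g
  exact LinearMap.trace_prodMap' (p.toRepresentation g) (q.toRepresentation g)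

end Subrepresentation

section OrthogonalParts

variable {G : Type*} [Group G] [Finite G] {Z : Set G} {a b : G → ℂ}

theorem exists_common_constituent (ha : IsCharacterOn Z a) (hb : IsCharacterOn Z b)
    (h : charPairing a b ≠ 0) : ∃ a₀ b₀ c : G → ℂ, IsCharacterOn Z a₀ ∧ IsCharacterOn Z b₀ ∧
      (∃ d : ℕ, 0 < d ∧ c 1 = d) ∧ a = a₀ + c ∧ b = b₀ + c := by
  obtain ⟨n, ρ, hρ, rfl⟩ := ha
  obtain ⟨m, τ, hτ, rfl⟩ := hb
  rw [charPairing_comm, charPairing_character, Nat.cast_ne_zero, ← pos_iff_ne_zero] at h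
  have := Module.nontrivial_of_finrank_pos h
  obtain ⟨f, hf⟩ := exists_ne (0 : Representation.IntertwiningMap ρ τ)
  have : NeZero (Nat.card G : ℂ) := ⟨by simp [Nat.card_pos.ne']⟩
  obtain ⟨c, hc⟩ := exists_isCompl f.ker
  obtain ⟨d, hd⟩ := exists_isCompl f.range
  have hrange : f.toLinearMap.range ≠ ⊥ := fun h0 =>
    hf (DFunLike.ext _ _ (LinearMap.congr_fun (LinearMap.range_eq_bot.1 h0)))
  refine ⟨_, _, f.range.toRepresentation.character,
    isCharacterOn_character fun z hz => toRepresentation_eq_neg_one f.ker (hρ z hz),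
    isCharacterOn_character fun z hz => toRepresentation_eq_neg_one d (hτ z hz),
    ⟨_, Nat.pos_of_ne_zero (mt Submodule.finrank_eq_zero.1 hrange), Representation.char_one _⟩,
    ?_, ?_⟩
  · rw [character_eq_add_of_isCompl hc, character_range_eq_of_isCompl_ker f hc.symm]
  · rw [character_eq_add_of_isCompl hd, add_comm]

theorem exists_orthogonal_parts (ha : IsCharacterOn Z a) (hb : IsCharacterOn Z b) :
    ∃ a' b', IsCharacterOn Z a' ∧ IsCharacterOn Z b' ∧ charPairing a' b' = 0 ∧
      a' - b' = a - b := by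
  obtain ⟨n, hn⟩ := ha.exists_apply_one_eq_natCast
  induction n using Nat.strong_induction_on generalizing a b with
  | _ n ih =>
  by_cases h : charPairing a b = 0
  · exact ⟨a, b, ha, hb, h, rfl⟩
  obtain ⟨a₀, b₀, c, ha₀, hb₀, ⟨d, hd, hc⟩, rfl, rfl⟩ := exists_common_constituent ha hb h
  obtain ⟨k, hk⟩ := ha₀.exists_apply_one_eq_natCast
  have hkd : k + d = n := by
    rw [Pi.add_apply, hk, hc] at hn
    exact_mod_cast hn
  simpa using ih k (by lia) ha₀ hb₀ hk

end OrthogonalParts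

end CharacterTheory

section Associate

variable {G : Type*} [Group G]

theorem isCharacter_monoidHom (d : G →* ℂ) : IsCharacter G d := by
  let ρ : Representation ℂ G ℂ := (algebraMap ℂ (Module.End ℂ ℂ) : ℂ →* Module.End ℂ ℂ).comp d
  have hρ : ρ.character = d := by
    ext g
    change LinearMap.trace ℂ ℂ (algebraMap ℂ (Module.End ℂ ℂ) (d g)) = d g
    rw [Algebra.algebraMap_eq_smul_one, map_smul, LinearMap.trace_one]
    simp
  rw [← hρ]
  exact isCharacter_iff.2 (isCharacterOn_character (by simp))

theorem apply_conj_of_mem_virtualCharacters {χ : G → ℂ} (hχ : χ ∈ virtualCharacters G) (g h : G) :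
    χ (h * g * h⁻¹) = χ g := by
  obtain ⟨a, b, ⟨n, ρ, rfl⟩, ⟨m, τ, rfl⟩, rfl⟩ := exists_sub_of_mem_virtualCharacters hχ
  simp only [Pi.sub_apply, Representation.char_conj]

variable [Finite G] {a b : G → ℂ}

theorem comp_eq_of_sub_comp_eq_neg (ha : IsCharacter G a) (hb : IsCharacter G b)
    (hab : charPairing a b = 0) (e : G ≃* G) (he : (a - b) ∘ e = -(a - b)) : b ∘ e = a := by
  have hcomp {χ : G → ℂ} (hχ : IsCharacter G χ) : IsCharacter G (χ ∘ e) :=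
    isCharacter_iff.2 ((isCharacter_iff.1 hχ).comp e.toMonoidHom (by simp))
  refine (orthogonal_parts_unique ha hb (hcomp hb) (hcomp ha) hab ?_ ?_).1.symm
  · rw [charPairing_comp_equiv, charPairing_comm, hab]
  · have he' : a ∘ e - b ∘ e = -(a - b) := he
    linear_combination he'

theorem mul_eq_of_mul_sub_eq_neg (ha : IsCharacter G a) (hb : IsCharacter G b)
    (hab : charPairing a b = 0) (d : G →* ℂ) (hd : ⇑d * (a - b) = -(a - b)) : ⇑d * a = b := by
  have := Fintype.ofFinite G
  have hmul {χ : G → ℂ} (hχ : IsCharacter G χ) : IsCharacter G (⇑d * χ) :=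
    isCharacter_iff.2 <|
      (isCharacter_monoidHom d).comp_mul (isCharacter_iff.1 hχ) (MonoidHom.id G) (by simp)
  have hdd (g : G) : d g * d g⁻¹ = 1 := by rw [← map_mul, mul_inv_cancel, map_one]
  refine (orthogonal_parts_unique ha hb (hmul hb) (hmul ha) hab ?_ ?_).2.symm
  · rw [charPairing_comm, ← hab, charPairing_eq_sum, charPairing_eq_sum]
    congr 1
    refine Finset.sum_congr rfl fun g _ => ?_
    simp only [Pi.mul_apply]
    linear_combination a g * b g⁻¹ * hdd g
  · linear_combination hd

end Associate

/-! ### Generators of the Clifford algebra and of its even part -/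

section ZeroMulSucc

namespace IsCliffordFamily

variable (k : Type*) {A : Type*} [CommRing k] [Ring A] [Algebra k A] {m : ℕ} {f : Fin (m + 1) → A}

theorem zero_mul_succ_mul_zero_mul_succ (hf : IsCliffordFamily f) (i j : Fin m) :
    f 0 * f i.succ * (f 0 * f j.succ) = f i.succ * f j.succ := by
  rw [hf.anti 0 i.succ (Fin.succ_ne_zero i).symm, neg_mul, mul_assoc, ← mul_assoc (f 0) (f 0),
    hf.sq, neg_one_mul, mul_neg, neg_neg]

theorem zero_mul_succ (hf : IsCliffordFamily f) :
    IsCliffordFamily fun j : Fin m => f 0 * f j.succ where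
  sq i := (hf.zero_mul_succ_mul_zero_mul_succ i i).trans (hf.sq _)
  anti i j hij := by
    simp only [hf.zero_mul_succ_mul_zero_mul_succ]
    exact hf.anti _ _ ((Fin.succ_injective m).ne hij)

theorem ofFn_zero_mul_succ_prod_mul (hf : IsCliffordFamily f) (hm : Odd m) (i : Fin (m + 1)) :
    (List.ofFn fun j : Fin m => f 0 * f j.succ).prod * f i =
      -f i * (List.ofFn fun j : Fin m => f 0 * f j.succ).prod := by
  suffices h : f i * (List.ofFn fun j : Fin m => f 0 * f j.succ).prod =
      (-1 : ℤ) • ((List.ofFn fun j : Fin m => f 0 * f j.succ).prod * f i) by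
    rw [neg_mul, h, neg_smul, neg_neg, one_smul]
  have hanti (j : Fin m) : f j.succ * f 0 = -(f 0 * f j.succ) := hf.anti _ _ (Fin.succ_ne_zero j)
  cases i using Fin.cases with
  | zero =>
    have h (j : Fin m) : f 0 * (f 0 * f j.succ) = (-1 : ℤ) • (f 0 * f j.succ * f 0) := by
      rw [mul_assoc (f 0) (f j.succ), hanti]
      simp
    simpa [hm.neg_one_pow] using mul_ofFn_prod_of_mul_eq_smul h
  | succ i =>
    have h (j : Fin m) : f i.succ * (f 0 * f j.succ) =
        (if j = i then (-1 : ℤ) else 1) • (f 0 * f j.succ * f i.succ) := by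
      rw [← mul_assoc, hanti, neg_mul, mul_assoc, mul_assoc]
      rcases eq_or_ne j i with rfl | hj
      · simp
      · simp [hj, hf.anti i.succ j.succ ((Fin.succ_injective m).ne hj.symm)]
    simpa using mul_ofFn_prod_of_mul_eq_smul h

theorem mul_mem_adjoin_zero_mul_succ (hf : IsCliffordFamily f) (i j : Fin (m + 1)) :
    f i * f j ∈ Algebra.adjoin k (Set.range fun j : Fin m => f 0 * f j.succ) := by
  have hgen (j : Fin m) : f 0 * f j.succ ∈
      Algebra.adjoin k (Set.range fun j : Fin m => f 0 * f j.succ) :=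
    Algebra.subset_adjoin ⟨j, rfl⟩
  cases i using Fin.cases with
  | zero =>
    cases j using Fin.cases with
    | zero =>
      rw [hf.sq]
      exact neg_mem (one_mem _)
    | succ j => exact hgen j
  | succ i =>
    cases j using Fin.cases with
    | zero =>
      rw [hf.anti _ _ (Fin.succ_ne_zero i)]
      exact neg_mem (hgen i)
    | succ j =>
      rw [← hf.zero_mul_succ_mul_zero_mul_succ]
      exact mul_mem (hgen i) (hgen j)

end IsCliffordFamily

end ZeroMulSucc

section CliffordGenerators

variable {E : Type*} [NormedAddCommGroup E] [InnerProductSpace ℝ E]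

theorem clι_mul_self (x : E) : clι E x * clι E x = -algebraMap ℝ (Cl E) (inner ℝ x x) := by
  rw [CliffordAlgebra.ι_sq_scalar, ← map_neg]
  rfl

theorem clι_mul_self_of_norm_eq_one {u : E} (hu : ‖u‖ = 1) : clι E u * clι E u = -1 := by
  rw [clι_mul_self, real_inner_self_eq_norm_sq, hu, one_pow, map_one]

theorem isCliffordSystem_clι {l : ℕ} (e : OrthonormalBasis (Fin l) ℝ E) :
    IsCliffordSystem ℝ fun i => clι E (e i) where
  sq i := clι_mul_self_of_norm_eq_one (e.norm_eq_one i)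
  anti i j h := by
    rw [eq_neg_iff_add_eq_zero, clι_mul_add_swap, e.inner_eq_zero h, mul_zero, map_zero]
  adjoin_eq_top := by
    rw [eq_top_iff, ← CliffordAlgebra.adjoin_range_ι, Algebra.adjoin_le_iff]
    rintro _ ⟨x, rfl⟩
    rw [SetLike.mem_coe, ← e.sum_repr x, map_sum]
    refine sum_mem fun i _ => ?_
    rw [map_smul]
    exact Subalgebra.smul_mem _ (Algebra.subset_adjoin (Set.mem_range_self i)) _

theorem mem_even_iff {x : Cl E} :
    x ∈ CliffordAlgebra.even (cliffordForm E) ↔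
      x ∈ CliffordAlgebra.evenOdd (cliffordForm E) 0 := by
  rw [← CliffordAlgebra.even_toSubmodule, Subalgebra.mem_toSubmodule]

theorem adjoin_clι_mul_clι {m : ℕ} (e : OrthonormalBasis (Fin (m + 1)) ℝ E) :
    Algebra.adjoin ℝ (Set.range fun j : Fin m => clι E (e 0) * clι E (e j.succ)) =
      CliffordAlgebra.even (cliffordForm E) := by
  apply le_antisymm
  · rw [Algebra.adjoin_le_iff]
    rintro _ ⟨j, rfl⟩
    exact mem_even_iff.2 (CliffordAlgebra.ι_mul_ι_mem_evenOdd_zero _ _ _)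
  · have hmul (x y : E) : clι E x * clι E y ∈
        Algebra.adjoin ℝ (Set.range fun j : Fin m => clι E (e 0) * clι E (e j.succ)) := by
      rw [← e.sum_repr x, ← e.sum_repr y]
      simp only [map_sum, map_smul, Finset.sum_mul, Finset.mul_sum, smul_mul_smul_comm]
      exact sum_mem fun i _ => sum_mem fun j _ => Subalgebra.smul_mem _
        ((isCliffordSystem_clι e).mul_mem_adjoin_zero_mul_succ ℝ _ _) _
    intro x hx
    rw [mem_even_iff] at hx
    induction x, hx using CliffordAlgebra.even_induction with
    | algebraMap r => exact Subalgebra.algebraMap_mem _ _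
    | add x y _ _ hx hy => exact add_mem hx hy
    | ι_mul_ι_mul a b x _ hx => exact mul_mem (hmul a b) hx

end CliffordGenerators

section SpinSystem

variable (E : Type*) [NormedAddCommGroup E] [InnerProductSpace ℝ E]

/-- The power `ε ^ (l + 1)` of the grading automorphism of `C(E)`, `l = dim E`: it is the identity
for `l` odd and `ε` for `l` even, and the product `φ` of an orthonormal basis satisfies
`φ x = ε ^ (l + 1) (x) φ`. -/
def spinTwist : Cl E →ₐ[ℝ] Cl E :=
  CliffordAlgebra.involute ^ (Module.finrank ℝ E + 1)

/-- The constant `c` with `|S⁺ - S⁻| ^ 2 = c * det (1 - w)` on the pin cover: `2` if `dim E` is odd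
and `1` if `dim E` is even. -/
def spinFactor : ℕ :=
  open Classical in if Odd (Module.finrank ℝ E) then 2 else 1

variable {E}

theorem involute_pow_two : (CliffordAlgebra.involute : Cl E →ₐ[ℝ] Cl E) ^ 2 = 1 :=
  AlgHom.ext fun x => CliffordAlgebra.involute_involute x

theorem spinTwist_of_odd (h : Odd (Module.finrank ℝ E)) : spinTwist E = 1 := by
  obtain ⟨n, hn⟩ := h.add_odd odd_one
  rw [spinTwist, hn, ← two_mul, pow_mul, involute_pow_two, one_pow]

theorem spinTwist_of_even (h : Even (Module.finrank ℝ E)) :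
    spinTwist E = CliffordAlgebra.involute := by
  obtain ⟨n, hn⟩ := h
  rw [spinTwist, hn, ← two_mul, pow_succ, pow_mul, involute_pow_two, one_pow, one_mul]

theorem spinAlgebra_of_odd (h : Odd (Module.finrank ℝ E)) : spinAlgebra E = ⊤ := by
  simp [spinAlgebra, h]

theorem spinAlgebra_of_even (h : Even (Module.finrank ℝ E)) :
    spinAlgebra E = CliffordAlgebra.even (cliffordForm E) := by
  simp [spinAlgebra, h]

theorem spinTwist_coe (x : spinAlgebra E) : spinTwist E x = x := by
  rcases Nat.even_or_odd (Module.finrank ℝ E) with h | h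
  · rw [spinTwist_of_even h]
    exact CliffordAlgebra.involute_eq_of_mem_even (mem_even_iff.1 (spinAlgebra_of_even h ▸ x.2))
  · rw [spinTwist_of_odd h, AlgHom.one_apply]

/-- Elements of the same parity as `dim E`; the volume elements are among them. -/
def HasSpinParity (x : Cl E) : Prop :=
  CliffordAlgebra.involute x = (-1 : ℝ) ^ Module.finrank ℝ E • x

theorem hasSpinParity_coe_of_even (h : Even (Module.finrank ℝ E)) (x : spinAlgebra E) :
    HasSpinParity (x : Cl E) := by
  rw [HasSpinParity, h.neg_one_pow, one_smul, ← spinTwist_of_even h, spinTwist_coe]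

theorem isCliffordSystem_of_coe {k A : Type*} [CommRing k] [Ring A] [Algebra k A]
    {S : Subalgebra k A} {m : ℕ} {f : Fin m → S} (hf : IsCliffordFamily fun i => (f i : A))
    (hgen : Algebra.adjoin k (Set.range fun i => (f i : A)) = S) : IsCliffordSystem k f where
  sq i := Subtype.ext (hf.sq i)
  anti i j h := Subtype.ext (hf.anti i j h)
  adjoin_eq_top := by
    apply Subalgebra.map_injective (f := S.val) Subtype.val_injective
    rw [AlgHom.map_adjoin, ← Set.range_comp, Algebra.map_top, Subalgebra.range_val]
    exact hgen

theorem coe_ofFn_prod {k A : Type*} [CommRing k] [Ring A] [Algebra k A] {S : Subalgebra k A}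
    {m : ℕ} (f : Fin m → S) : ((List.ofFn f).prod : A) = (List.ofFn fun i => (f i : A)).prod := by
  rw [← S.coe_val, map_list_prod, List.map_ofFn]
  rfl

/-- A Clifford system of odd length in `C(E)` (`dim E` odd) or `C(E)_even` (`dim E` even) whose
ordered product is a volume element of `C(E)`. -/
structure IsSpinSystem {m : ℕ} (f : Fin m → spinAlgebra E) : Prop extends IsCliffordSystem ℝ f where
  odd_length : Odd m
  two_pow_length_succ : 2 ^ (m + 1) = spinFactor E * 2 ^ Module.finrank ℝ E
  ofFn_prod_mul : ∀ x : Cl E,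
    ((List.ofFn f).prod : Cl E) * x = spinTwist E x * ((List.ofFn f).prod : Cl E)
  hasSpinParity : HasSpinParity ((List.ofFn f).prod : Cl E)

variable [FiniteDimensional ℝ E]

theorem exists_isSpinSystem_of_odd (h : Odd (Module.finrank ℝ E)) :
    ∃ f : Fin (Module.finrank ℝ E) → spinAlgebra E, IsSpinSystem f := by
  have he := isCliffordSystem_clι (stdOrthonormalBasis ℝ E)
  let f (j : Fin (Module.finrank ℝ E)) : spinAlgebra E :=
    ⟨clι E (stdOrthonormalBasis ℝ E j), by simp [spinAlgebra_of_odd h]⟩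
  refine ⟨f, isCliffordSystem_of_coe he.toIsCliffordFamily
    (he.adjoin_eq_top.trans (spinAlgebra_of_odd h).symm), h, ?_, fun x => ?_, ?_⟩
  · simp [spinFactor, h, pow_succ, mul_comm]
  · rw [spinTwist_of_odd h, coe_ofFn_prod]
    exact he.commute_ofFn_prod h x
  · rw [HasSpinParity, coe_ofFn_prod, map_ofFn_prod_of_map_eq_smul (s := fun _ => (-1 : ℝ))]
    · simp
    · simp [f]

theorem exists_isSpinSystem_of_even {m : ℕ} (hm : Odd m) (h : Module.finrank ℝ E = m + 1) :
    ∃ f : Fin m → spinAlgebra E, IsSpinSystem f := by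
  have heven : Even (Module.finrank ℝ E) := h ▸ hm.add_odd odd_one
  let e : OrthonormalBasis (Fin (m + 1)) ℝ E := (stdOrthonormalBasis ℝ E).reindex (finCongr h)
  have he := isCliffordSystem_clι e
  have hgen := (adjoin_clι_mul_clι e).trans (spinAlgebra_of_even heven).symm
  let f (j : Fin m) : spinAlgebra E :=
    ⟨clι E (e 0) * clι E (e j.succ), hgen ▸ Algebra.subset_adjoin ⟨j, rfl⟩⟩
  refine ⟨f, isCliffordSystem_of_coe he.zero_mul_succ hgen, hm, ?_, ?_,
    hasSpinParity_coe_of_even heven _⟩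
  · simp [spinFactor, h, hm]
  · rw [spinTwist_of_even heven, coe_ofFn_prod]
    refine mul_eq_map_mul_of_adjoin_eq_top he.adjoin_eq_top CliffordAlgebra.involute ?_
    rintro _ ⟨i, rfl⟩
    rw [CliffordAlgebra.involute_ι]
    exact he.ofFn_zero_mul_succ_prod_mul hm i

variable (E) in
theorem exists_isSpinSystem [Nontrivial E] :
    ∃ (m : ℕ) (f : Fin m → spinAlgebra E), IsSpinSystem f := by
  rcases Nat.even_or_odd (Module.finrank ℝ E) with h | h
  · obtain ⟨m, hm⟩ := Nat.exists_eq_succ_of_ne_zero (Module.finrank_pos (R := ℝ) (M := E)).ne'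
    have hodd : Odd m := by
      rwa [hm, Nat.succ_eq_add_one, Nat.even_add_one, Nat.not_even_iff_odd] at h
    exact ⟨m, exists_isSpinSystem_of_even hodd hm⟩
  · exact ⟨_, exists_isSpinSystem_of_odd h⟩

end SpinSystem

/-! ### The square of the virtual spin character -/

section SpinForm

variable {E : Type*} [NormedAddCommGroup E] [InnerProductSpace ℝ E]

/-- The operator `x ↦ a θ(x) b` on the Clifford algebra, where `θ` is `spinTwist`. -/
def spinOp : spinAlgebra E →ₗ[ℝ] spinAlgebra E →ₗ[ℝ] Module.End ℝ (Cl E) :=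
  LinearMap.mk₂ ℝ
    (fun a b => LinearMap.mulLeft ℝ a ∘ₗ LinearMap.mulRight ℝ b ∘ₗ (spinTwist E).toLinearMap)
    (by intros; ext; simp [add_mul]) (by intros; ext; simp) (by intros; ext; simp [mul_add])
    (by intros; ext; simp)

theorem spinOp_apply (a b : spinAlgebra E) (x : Cl E) :
    spinOp a b x = a * (spinTwist E x * b) := rfl

/-- The trace of `x ↦ a θ(x) b` on the Clifford algebra. It is tracial in `a` and in `b`, as is
`(S⁺ - S⁻)(a) * (S⁺ - S⁻)(b)`, and the two are proportional if `b` has the parity of `dim E`. -/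
def spinForm : spinAlgebra E →ₗ[ℝ] spinAlgebra E →ₗ[ℝ] ℂ :=
  spinOp.compr₂ (Algebra.linearMap ℝ ℂ ∘ₗ LinearMap.trace ℝ (Cl E))

theorem spinForm_apply (a b : spinAlgebra E) :
    spinForm a b = (LinearMap.trace ℝ (Cl E) (spinOp a b) : ℂ) := rfl

theorem spinForm_mul_left (u v b : spinAlgebra E) : spinForm (u * v) b = spinForm (v * u) b := by
  have huv : spinOp (u * v) b = LinearMap.mulLeft ℝ (u : Cl E) * spinOp v b := by
    ext x
    simp [spinOp_apply, mul_assoc]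
  have hvu : spinOp (v * u) b = spinOp v b * LinearMap.mulLeft ℝ (u : Cl E) := by
    ext x
    simp [spinOp_apply, mul_assoc, spinTwist_coe]
  rw [spinForm_apply, spinForm_apply, huv, hvu, LinearMap.trace_mul_comm]

theorem spinForm_mul_right (a u v : spinAlgebra E) : spinForm a (u * v) = spinForm a (v * u) := by
  have hvu : spinOp a (v * u) = LinearMap.mulRight ℝ (u : Cl E) * spinOp a v := by
    ext x
    simp [spinOp_apply, mul_assoc]
  have huv : spinOp a (u * v) = spinOp a v * LinearMap.mulRight ℝ (u : Cl E) := by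
    ext x
    simp [spinOp_apply, mul_assoc, spinTwist_coe]
  rw [spinForm_apply, spinForm_apply, hvu, huv, LinearMap.trace_mul_comm]

theorem trace_eq_zero_of_anticommute {k V : Type*} [Field k] [CharZero k] [AddCommGroup V]
    [Module k V] {f g : Module.End k V} {c : k} (hc : c ≠ 0) (hg : g * g = c • 1)
    (hfg : f * g = -(g * f)) : LinearMap.trace k V f = 0 := by
  have h : c • LinearMap.trace k V f = -(c • LinearMap.trace k V f) := calc
    _ = LinearMap.trace k V (f * g * g) := by simp [mul_assoc, hg]
    _ = -LinearMap.trace k V (g * g * f) := by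
      rw [LinearMap.trace_mul_comm, hfg, mul_neg, map_neg, mul_assoc]
    _ = -(c • LinearMap.trace k V f) := by simp [hg]
  exact (smul_eq_zero.1 (self_eq_neg.1 h)).resolve_left hc

theorem exists_clι_mul_self_eq_neg_one (E : Type*) [NormedAddCommGroup E] [InnerProductSpace ℝ E]
    [Nontrivial E] : ∃ u : E, clι E u * clι E u = -1 := by
  obtain ⟨u, hu⟩ := exists_norm_eq E zero_le_one
  exact ⟨u, clι_mul_self_of_norm_eq_one hu⟩

variable [Nontrivial E]

theorem spinForm_one_left {b : spinAlgebra E} (hb : HasSpinParity (b : Cl E)) :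
    spinForm 1 b = 0 := by
  rw [spinForm_apply, Complex.ofReal_eq_zero]
  rcases Nat.even_or_odd (Module.finrank ℝ E) with h | h
  · obtain ⟨u, hu⟩ := exists_clι_mul_self_eq_neg_one E
    refine trace_eq_zero_of_anticommute (g := LinearMap.mulLeft ℝ (clι E u)) (c := -1) (by simp)
      ?_ ?_ <;> ext x
    · simp [← mul_assoc, hu]
    · simp [spinOp_apply, spinTwist_of_even h, mul_assoc]
  · refine trace_eq_zero_of_anticommute (g := CliffordAlgebra.involute.toLinearMap) one_ne_zero
      ?_ ?_ <;> ext x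
    · simp
    · rw [HasSpinParity, h.neg_one_pow] at hb
      simp [spinOp_apply, spinTwist_of_odd h, hb]

theorem spinForm_one_right {a : spinAlgebra E} (ha : HasSpinParity (a : Cl E)) :
    spinForm a 1 = 0 := by
  rw [spinForm_apply, Complex.ofReal_eq_zero]
  rcases Nat.even_or_odd (Module.finrank ℝ E) with h | h
  · obtain ⟨u, hu⟩ := exists_clι_mul_self_eq_neg_one E
    refine trace_eq_zero_of_anticommute (g := LinearMap.mulRight ℝ (clι E u)) (c := -1) (by simp)
      ?_ ?_ <;> ext x
    · simp [mul_assoc, hu]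
    · simp [spinOp_apply, spinTwist_of_even h, mul_assoc]
  · refine trace_eq_zero_of_anticommute (g := CliffordAlgebra.involute.toLinearMap) one_ne_zero
      ?_ ?_ <;> ext x
    · simp
    · rw [HasSpinParity, h.neg_one_pow] at ha
      simp [spinOp_apply, spinTwist_of_odd h, ha]

end SpinForm

section SpinSquare

variable {E : Type*} [NormedAddCommGroup E] [InnerProductSpace ℝ E] [FiniteDimensional ℝ E]
  {S₁ S₂ : Type*} [AddCommGroup S₁] [Module ℂ S₁] [FiniteDimensional ℂ S₁]
  [AddCommGroup S₂] [Module ℂ S₂] [FiniteDimensional ℂ S₂]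
  {ρ₁ : spinAlgebra E →ₐ[ℝ] Module.End ℂ S₁} {ρ₂ : spinAlgebra E →ₐ[ℝ] Module.End ℂ S₂}

theorem IsSpinSystem.spinForm_ofFn_prod {m : ℕ} {f : Fin m → spinAlgebra E} (hf : IsSpinSystem f)
    {η : ℝ} (hη : (List.ofFn f).prod * (List.ofFn f).prod = algebraMap ℝ (spinAlgebra E) η) :
    spinForm (List.ofFn f).prod (List.ofFn f).prod = η * 2 ^ Module.finrank ℝ E := by
  have hη : ((List.ofFn f).prod : Cl E) * ((List.ofFn f).prod : Cl E) = algebraMap ℝ (Cl E) η :=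
    congrArg Subtype.val hη
  have hop : spinOp (List.ofFn f).prod (List.ofFn f).prod = η • 1 := by
    ext x
    rw [spinOp_apply, ← hf.ofFn_prod_mul, ← mul_assoc, hη, ← Algebra.smul_def]
    rfl
  rw [spinForm_apply, hop, map_smul, LinearMap.trace_one,
    finrank_cliffordAlgebra _ (Module.finBasis ℝ E)]
  simp

theorem traceDiff_mul_traceDiff [Nontrivial E] (hρ₁ : IsSimpleModuleHom ρ₁)
    (hρ₂ : IsSimpleModuleHom ρ₂) (hρ : ¬ AreIsomorphic ρ₁ ρ₂) (a : spinAlgebra E)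
    {b : spinAlgebra E} (hb : HasSpinParity (b : Cl E)) :
    traceDiff ρ₁ ρ₂ a * traceDiff ρ₁ ρ₂ b = spinFactor E * spinForm a b := by
  obtain ⟨m, f, hf⟩ := exists_isSpinSystem E
  obtain ⟨η, hη, hφ⟩ := hf.exists_ofFn_prod_mul_self ℝ
  have hη' : (η : ℂ) * η = 1 := by exact_mod_cast hη
  have hsq := hf.traceDiff_ofFn_prod_sq hf.odd_length hρ₁ hρ₂ hρ hη hφ
  have hone := hf.traceDiff_one ρ₁ ρ₂ hf.odd_length hρ₁ hρ₂
  have hpow : (2 : ℂ) ^ (m + 1) = spinFactor E * 2 ^ Module.finrank ℝ E := by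
    exact_mod_cast hf.two_pow_length_succ
  have hself := hf.spinForm_ofFn_prod hφ
  set φ := (List.ofFn f).prod
  have hleft : traceDiff ρ₁ ρ₂ φ * spinForm a b = spinForm φ b * traceDiff ρ₁ ρ₂ a :=
    hf.tracial_smul_eq (U := spinForm.flip b) (traceDiff_mul_comm ρ₁ ρ₂)
      (fun u v => spinForm_mul_left u v b) hone (spinForm_one_left hb) a
  have hright : traceDiff ρ₁ ρ₂ φ * spinForm φ b = spinForm φ φ * traceDiff ρ₁ ρ₂ b :=
    hf.tracial_smul_eq (U := spinForm φ) (traceDiff_mul_comm ρ₁ ρ₂) (spinForm_mul_right φ) hone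
      (spinForm_one_right hf.hasSpinParity) b
  have hpow_ne : (2 : ℂ) ^ Module.finrank ℝ E ≠ 0 := pow_ne_zero _ two_ne_zero
  refine mul_left_cancel₀ hpow_ne ?_
  rw [hself] at hright
  linear_combination -η * (traceDiff ρ₁ ρ₂ φ * hleft + traceDiff ρ₁ ρ₂ a * hright -
    spinForm a b * hsq) - (traceDiff ρ₁ ρ₂ a * traceDiff ρ₁ ρ₂ b * 2 ^ Module.finrank ℝ E -
      spinForm a b * 2 ^ (m + 1)) * hη' + spinForm a b * hpow

end SpinSquare

/-! ### The pin group as a double cover of the orthogonal group -/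

section PinHom

variable {E : Type*} [NormedAddCommGroup E] [InnerProductSpace ℝ E]

/-- The operator `x ↦ -u ε(x) u` on the Clifford algebra. For a unit vector `u` it is an
involution, which fixes the elements `a` with `ε(a) u = u a`. -/
def negConj (u : E) : Module.End ℝ (Cl E) :=
  -(LinearMap.mulLeft ℝ (clι E u) ∘ₗ LinearMap.mulRight ℝ (clι E u) ∘ₗ
    CliffordAlgebra.involute.toLinearMap)

theorem negConj_apply (u : E) (x : Cl E) :
    negConj u x = -(clι E u * (CliffordAlgebra.involute x * clι E u)) := rfl

theorem negConj_eq_self {u : E} (hu : ‖u‖ = 1) {a : Cl E}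
    (ha : CliffordAlgebra.involute a * clι E u = clι E u * a) : negConj u a = a := by
  rw [negConj_apply, ha, ← mul_assoc, clι_mul_self_of_norm_eq_one hu, neg_one_mul, neg_neg]

theorem neg_clι_mul_mul_neg {u : E} (hu : ‖u‖ = 1) (ξ : E) :
    -clι E u * clι E ξ * -clι E u = clι E (ξ - (2 * inner ℝ u ξ) • u) := by
  rw [neg_mul, neg_mul_neg, eq_sub_of_add_eq (clι_mul_add_swap E u ξ), sub_mul, mul_assoc,
    clι_mul_self_of_norm_eq_one hu, ← Algebra.smul_def, map_sub, map_smul, mul_neg, mul_one]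
  module

theorem reflection_orthogonal_span_singleton_apply {u : E} (hu : ‖u‖ = 1) (ξ : E) :
    (ℝ ∙ u)ᗮ.reflection ξ = ξ - (2 * inner ℝ u ξ) • u := by
  rw [Submodule.reflection_orthogonal_apply, Submodule.reflection_singleton_apply, hu]
  simp [mul_smul, two_smul]

theorem negConj_word {l : ℕ} (e : OrthonormalBasis (Fin l) ℝ E) (i : Fin l) (I : Fin l → Bool) :
    negConj (e i) (word (fun j => clι E (e j)) I) =
      (if I i then (-1 : ℝ) else 1) • word (fun j => clι E (e j)) I := by
  have hinv := map_word_of_map_eq_smul CliffordAlgebra.involute (s := fun _ => (-1 : ℝ))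
    (f := fun j => clι E (e j)) (fun j => by simp) I
  have hsign : (∏ j, if I j then (-1 : ℝ) else 1) * (∏ j, if I j then (-1 : ℝ) else 1) = 1 := by
    rw [← Finset.prod_mul_distrib]
    exact Finset.prod_eq_one fun j _ => by split_ifs <;> norm_num
  rw [negConj_apply, hinv, smul_mul_assoc, mul_smul_comm, ← mul_assoc,
    (isCliffordSystem_clι e).toIsCliffordFamily.mul_word ℝ i I, smul_mul_assoc, mul_assoc,
    clι_mul_self_of_norm_eq_one (e.norm_eq_one i), smul_smul, ← mul_assoc, hsign, one_mul,
    mul_neg_one, smul_neg, neg_neg]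

variable [FiniteDimensional ℝ E]

theorem det_eq_one_or_neg_one_of_inner_map_map {w : E ≃ₗ[ℝ] E}
    (hw : ∀ x y, inner ℝ (w x) (w y) = inner ℝ x y) :
    LinearMap.det (w : E →ₗ[ℝ] E) = 1 ∨ LinearMap.det (w : E →ₗ[ℝ] E) = -1 := by
  refine eq_or_eq_neg_of_abs_eq ?_
  rw [← LinearMap.normDet_eq_abs_det]
  exact (w.isometryOfInner hw).toLinearIsometry.normDet_eq_one

theorem eq_algebraMap_of_involute_mul_eq {a : Cl E}
    (ha : ∀ ξ, CliffordAlgebra.involute a * clι E ξ = clι E ξ * a) :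
    ∃ r : ℝ, a = algebraMap ℝ (Cl E) r := by
  let e := stdOrthonormalBasis ℝ E
  let P := (List.ofFn fun i => 1 + negConj (e i)).prod
  have hP (x : Cl E) : P x ∈ LinearMap.range (Algebra.linearMap ℝ (Cl E)) := by
    have hx : x ∈ Submodule.span ℝ (Set.range (word fun i => clι E (e i))) := by
      rw [(isCliffordSystem_clι e).span_word]
      exact Submodule.mem_top
    induction hx using Submodule.span_induction with
    | mem x hx =>
      obtain ⟨I, rfl⟩ := hx
      rw [ofFn_one_add_prod_apply fun i => negConj_word e i I]
      by_cases hI : ∃ i, I i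
      · obtain ⟨i, hi⟩ := hI
        rw [Finset.prod_eq_zero (Finset.mem_univ i) (by simp [hi]), zero_smul]
        exact zero_mem _
      · obtain rfl : I = fun _ => false := funext fun i => by simpa using not_exists.1 hI i
        rw [word_false]
        exact Submodule.smul_mem _ _ ⟨1, by simp⟩
    | zero => simp
    | add x y _ _ hx hy =>
      rw [map_add]
      exact add_mem hx hy
    | smul r x _ hx =>
      rw [map_smul]
      exact Submodule.smul_mem _ _ hx
  have hPa : P a = (2 : ℝ) ^ Module.finrank ℝ E • a := by
    rw [ofFn_one_add_prod_apply (s := fun _ => (1 : ℝ)) fun i => by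
      rw [negConj_eq_self (e.norm_eq_one i) (ha _), one_smul]]
    simp [one_add_one_eq_two]
  obtain ⟨r, hr⟩ := (Submodule.smul_mem_iff _ (pow_ne_zero _ two_ne_zero)).1 (hPa ▸ hP a)
  exact ⟨r, hr.symm⟩

theorem clι_pinHom_eq_mul_involute_inv (a : Pin E) (ξ : E) :
    clι E (pinHom E a ξ) = (a : (Cl E)ˣ) * clι E ξ *
      CliffordAlgebra.involute (((a : (Cl E)ˣ)⁻¹ : (Cl E)ˣ) : Cl E) := by
  have h := congrArg CliffordAlgebra.involute (clι_pinHom E a ξ)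
  simpa using h

theorem inner_pinHom (a : Pin E) (x y : E) :
    inner ℝ (pinHom E a x) (pinHom E a y) = inner ℝ x y := by
  have hinv : CliffordAlgebra.involute ((a : (Cl E)ˣ) : Cl E) *
      CliffordAlgebra.involute (((a : (Cl E)ˣ)⁻¹ : (Cl E)ˣ) : Cl E) = 1 := by
    rw [← map_mul, Units.mul_inv, map_one]
  have hmul (x y : E) : clι E (pinHom E a x) * clι E (pinHom E a y) =
      CliffordAlgebra.involute ((a : (Cl E)ˣ) : Cl E) * (clι E x * clι E y) *
        CliffordAlgebra.involute (((a : (Cl E)ˣ)⁻¹ : (Cl E)ˣ) : Cl E) := by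
    rw [clι_pinHom, clι_pinHom_eq_mul_involute_inv]
    simp only [mul_assoc, Units.inv_mul_cancel_left]
  have h := clι_mul_add_swap E (pinHom E a x) (pinHom E a y)
  rw [hmul, hmul, ← add_mul, ← mul_add, clι_mul_add_swap, ← Algebra.commutes, mul_assoc, hinv,
    mul_one] at h
  have := (algebraMap ℝ (Cl E)).injective h
  linarith

theorem coe_eq_one_or_neg_one_of_pinHom_eq_one {a : Pin E} (ha : pinHom E a = 1) :
    ((a : (Cl E)ˣ) : Cl E) = 1 ∨ ((a : (Cl E)ˣ) : Cl E) = -1 := by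
  obtain ⟨r, hr⟩ := eq_algebraMap_of_involute_mul_eq (a := ((a : (Cl E)ˣ) : Cl E)) fun ξ => by
    have h := clι_pinHom E a ξ
    rw [ha, LinearEquiv.coe_one, id] at h
    conv_rhs => rw [h]
    simp
  have hstar : star ((a : (Cl E)ˣ) : Cl E) * ((a : (Cl E)ˣ) : Cl E) = 1 := by
    rw [a.2.2, Units.inv_mul]
  rw [hr, CliffordAlgebra.star_algebraMap, ← map_mul, ← map_one (algebraMap ℝ (Cl E))] at hstar
  rcases mul_self_eq_one_iff.1 ((algebraMap ℝ (Cl E)).injective hstar) with rfl | rfl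
  · exact Or.inl (by rw [hr, map_one])
  · exact Or.inr (by rw [hr, map_neg, map_one])

theorem exists_pinHom_eq_reflection {u : E} (hu : ‖u‖ = 1) :
    ∃ a : Pin E, pinHom E a = (ℝ ∙ u)ᗮ.reflection.toLinearEquiv ∧
      ((a : (Cl E)ˣ) : Cl E) = clι E u := by
  let v : (Cl E)ˣ := ⟨clι E u, -clι E u, by rw [mul_neg, clι_mul_self_of_norm_eq_one hu, neg_neg],
    by rw [neg_mul, clι_mul_self_of_norm_eq_one hu, neg_neg]⟩
  have hconj (ξ : E) : CliffordAlgebra.involute (v : Cl E) * clι E ξ * ((v⁻¹ : (Cl E)ˣ) : Cl E) =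
      clι E ((ℝ ∙ u)ᗮ.reflection ξ) := by
    rw [reflection_orthogonal_span_singleton_apply hu, ← neg_clι_mul_mul_neg hu]
    exact congrArg (· * clι E ξ * -clι E u) (CliffordAlgebra.involute_ι u)
  let a : Pin E := ⟨v, fun ξ => ⟨_, (hconj ξ).symm⟩, CliffordAlgebra.star_ι u⟩
  exact ⟨a, LinearEquiv.ext fun ξ => clι_injective E ((clι_pinHom E a ξ).trans (hconj ξ)), rfl⟩

theorem det_pinHom_mul (a b : Pin E) : LinearMap.det (pinHom E (a * b) : E →ₗ[ℝ] E) =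
    LinearMap.det (pinHom E a : E →ₗ[ℝ] E) * LinearMap.det (pinHom E b : E →ₗ[ℝ] E) := by
  rw [map_mul, ← map_mul LinearMap.det]
  rfl

theorem exists_pinHom_eq_reflection_and_involute (v : E) :
    ∃ a : Pin E, pinHom E a = (ℝ ∙ v)ᗮ.reflection.toLinearEquiv ∧
      CliffordAlgebra.involute ((a : (Cl E)ˣ) : Cl E) =
        LinearMap.det (pinHom E a : E →ₗ[ℝ] E) • ((a : (Cl E)ˣ) : Cl E) := by
  rcases eq_or_ne v 0 with rfl | hv
  · refine ⟨1, LinearEquiv.ext fun ξ => ?_, by simp⟩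
    simpa using (Submodule.reflection_mem_subspace_eq_self (Submodule.mem_top (x := ξ))).symm
  · have hnorm : ‖v‖⁻¹ ≠ 0 := inv_ne_zero (norm_ne_zero_iff.2 hv)
    have hunit : ‖‖v‖⁻¹ • v‖ = 1 := norm_smul_inv_norm (𝕜 := ℝ) hv
    obtain ⟨a, ha, hav⟩ := exists_pinHom_eq_reflection hunit
    have hspan : (ℝ ∙ (‖v‖⁻¹ • v)) = ℝ ∙ v :=
      Submodule.span_singleton_smul_eq (IsUnit.mk0 _ hnorm) v
    have hdet : LinearMap.det (pinHom E a : E →ₗ[ℝ] E) = -1 := by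
      rw [ha]
      refine (Submodule.det_reflection _).trans ?_
      rw [Submodule.orthogonal_orthogonal, finrank_span_singleton (smul_ne_zero hnorm hv), pow_one]
    refine ⟨a, ?_, ?_⟩
    · rw [ha]
      simp only [hspan]
    · rw [hdet, hav, CliffordAlgebra.involute_ι, neg_one_smul]

theorem exists_pinHom_eq_linearIsometryEquiv (φ : E ≃ₗᵢ[ℝ] E) :
    ∃ a : Pin E, pinHom E a = φ.toLinearEquiv ∧
      CliffordAlgebra.involute ((a : (Cl E)ˣ) : Cl E) =
        LinearMap.det (pinHom E a : E →ₗ[ℝ] E) • ((a : (Cl E)ˣ) : Cl E) := by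
  obtain ⟨vs, -, rfl⟩ := φ.reflections_generate_dim
  induction vs with
  | nil => exact ⟨1, by simp; rfl, by simp⟩
  | cons v vs ih =>
    obtain ⟨a, ha, ha'⟩ := exists_pinHom_eq_reflection_and_involute v
    obtain ⟨b, hb, hb'⟩ := ih
    refine ⟨a * b, ?_, ?_⟩
    · rw [map_mul, ha, hb, List.map_cons, List.prod_cons]
      rfl
    · rw [det_pinHom_mul, Subgroup.coe_mul, Units.val_mul, map_mul, ha', hb', smul_mul_smul_comm]

theorem exists_pinHom_eq {w : E ≃ₗ[ℝ] E} (hw : ∀ x y, inner ℝ (w x) (w y) = inner ℝ x y) :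
    ∃ a : Pin E, pinHom E a = w :=
  (exists_pinHom_eq_linearIsometryEquiv (w.isometryOfInner hw)).imp fun _ h => h.1

theorem involute_coe_pin (a : Pin E) : CliffordAlgebra.involute ((a : (Cl E)ˣ) : Cl E) =
    LinearMap.det (pinHom E a : E →ₗ[ℝ] E) • ((a : (Cl E)ˣ) : Cl E) := by
  obtain ⟨b, hb, hb'⟩ :=
    exists_pinHom_eq_linearIsometryEquiv ((pinHom E a).isometryOfInner (inner_pinHom a))
  have hba : pinHom E b = pinHom E a := hb
  have hab : a = b * (b⁻¹ * a) := (mul_inv_cancel_left b a).symm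
  have hker : pinHom E (b⁻¹ * a) = 1 := by rw [map_mul, map_inv, hba, inv_mul_cancel]
  rw [hba] at hb'
  rcases coe_eq_one_or_neg_one_of_pinHom_eq_one hker with h | h
  · have : ((a : (Cl E)ˣ) : Cl E) = (b : (Cl E)ˣ) := by
      rw [hab, Subgroup.coe_mul, Units.val_mul, h, mul_one]
    rw [this, hb']
  · have : ((a : (Cl E)ˣ) : Cl E) = -(b : (Cl E)ˣ) := by
      rw [hab, Subgroup.coe_mul, Units.val_mul, h, mul_neg_one]
    rw [this, map_neg, hb', smul_neg]

end PinHom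

/-! ### The virtual spin character of the pin cover -/

section DetOneSub

variable {E : Type*} [AddCommGroup E] [Module ℝ E]

theorem detOneSub_eq_mul_inv (w : E ≃ₗ[ℝ] E) : detOneSub w =
    (-1) ^ Module.finrank ℝ E * LinearMap.det (w : E →ₗ[ℝ] E) * detOneSub w⁻¹ := by
  have h : 1 - (w : E →ₗ[ℝ] E) =
      (-1 : ℝ) • ((w : E →ₗ[ℝ] E) * (1 - ((w⁻¹ : E ≃ₗ[ℝ] E) : E →ₗ[ℝ] E))) := by
    ext x
    simp
  rw [detOneSub, h, LinearMap.det_smul, map_mul, detOneSub, mul_assoc]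

variable [FiniteDimensional ℝ E]

theorem eval_one_detOneSubX (w : E ≃ₗ[ℝ] E) : (detOneSubX w).eval 1 = (detOneSub w : ℂ) := by
  have h : (LinearMap.toMatrix (Module.finBasis ℝ E) (Module.finBasis ℝ E)
      (w : E →ₗ[ℝ] E)).charpolyRev.eval 1 = detOneSub w := by
    rw [Matrix.charpolyRev, ← Polynomial.coe_evalRingHom, RingHom.map_det, detOneSub,
      ← LinearMap.det_toMatrix (Module.finBasis ℝ E),
      map_sub (LinearMap.toMatrix (Module.finBasis ℝ E) (Module.finBasis ℝ E)),
      LinearMap.toMatrix_one]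
    congr 1
    ext i j
    rcases eq_or_ne i j with h | h <;> simp [h]
  rw [detOneSubX, Polynomial.eval_map, ← map_one (algebraMap ℝ ℂ), Polynomial.eval₂_at_apply, h]
  rfl

theorem detOneSub_inv {w : E ≃ₗ[ℝ] E} (hw : IsOfFinOrder w) : detOneSub w⁻¹ = detOneSub w := by
  have h := congrArg (Polynomial.eval 1) (detOneSubX_inv hw)
  rw [eval_one_detOneSubX, eval_one_detOneSubX] at h
  exact_mod_cast h

theorem detOneSub_eq_zero {w : E ≃ₗ[ℝ] E} (hw : IsOfFinOrder w)
    (h : LinearMap.det (w : E →ₗ[ℝ] E) = (-1) ^ (Module.finrank ℝ E + 1)) : detOneSub w = 0 := by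
  have hneg := detOneSub_eq_mul_inv w
  have hsign : (-1 : ℝ) ^ Module.finrank ℝ E * (-1) ^ (Module.finrank ℝ E + 1) = -1 := by
    rw [pow_succ, ← mul_assoc, ← mul_pow, neg_one_mul, neg_neg, one_pow, one_mul]
  rw [detOneSub_inv hw, h, hsign, neg_one_mul] at hneg
  exact self_eq_neg.1 hneg

end DetOneSub

section PinCover

variable {E : Type*} [NormedAddCommGroup E] [InnerProductSpace ℝ E]

theorem mem_spinAlgebra_iff_of_even (h : Even (Module.finrank ℝ E)) {x : Cl E} :
    x ∈ spinAlgebra E ↔ CliffordAlgebra.involute x = x := by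
  rw [spinAlgebra_of_even h, ← Subalgebra.mem_toSubmodule, CliffordAlgebra.even_toSubmodule]
  refine ⟨fun hx => CliffordAlgebra.involute_eq_of_mem_even hx, fun hx => ?_⟩
  have htop := (CliffordAlgebra.evenOdd_isCompl (Q := cliffordForm E)).sup_eq_top
  obtain ⟨y, hy, z, hz, rfl⟩ := Submodule.mem_sup.1 (htop ▸ Submodule.mem_top (x := x))
  rw [map_add, CliffordAlgebra.involute_eq_of_mem_even hy,
    CliffordAlgebra.involute_eq_of_mem_odd hz, add_right_inj, neg_eq_iff_add_eq_zero,
    ← two_smul ℝ, smul_eq_zero] at hx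
  rw [hx.resolve_left two_ne_zero, add_zero]
  exact hy

variable [FiniteDimensional ℝ E] {W : Subgroup (E ≃ₗ[ℝ] E)}

theorem coe_pin_injective : Function.Injective fun g : Pin E => ((g : (Cl E)ˣ) : Cl E) :=
  fun _ _ h => Subtype.ext (Units.ext h)

theorem coverProj_coe (g : pinCover' W) : (coverProj W g : E ≃ₗ[ℝ] E) = pinHom E g := rfl

instance finite_pinCover' [Finite W] : Finite (pinCover' W) := by
  have hker : Finite (coverProj W).ker :=
    Finite.of_injective (β := ({1, -1} : Set (Cl E)))
      (fun g => ⟨(((g : pinCover' W) : Pin E) : (Cl E)ˣ),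
        coe_eq_one_or_neg_one_of_pinHom_eq_one (congrArg Subtype.val g.2)⟩)
      fun g h hgh => Subtype.ext (Subtype.ext (coe_pin_injective (congrArg Subtype.val hgh)))
  exact (MonoidHom.finite_iff_finite_ker_range (coverProj W)).2 ⟨hker, inferInstance⟩

theorem isOfFinOrder_pinHom [Finite W] (g : pinCover' W) : IsOfFinOrder (pinHom E g) :=
  W.subtype.isOfFinOrder (isOfFinOrder_of_finite (coverProj W g))

theorem det_pinHom (a : Pin E) : LinearMap.det (pinHom E a : E →ₗ[ℝ] E) = 1 ∨
    LinearMap.det (pinHom E a : E →ₗ[ℝ] E) = -1 :=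
  det_eq_one_or_neg_one_of_inner_map_map (inner_pinHom a)

theorem coe_mem_spinAlgebra_iff_of_even (h : Even (Module.finrank ℝ E)) (a : Pin E) :
    ((a : (Cl E)ˣ) : Cl E) ∈ spinAlgebra E ↔ LinearMap.det (pinHom E a : E →ₗ[ℝ] E) = 1 := by
  rw [mem_spinAlgebra_iff_of_even h, involute_coe_pin]
  refine ⟨fun ha => ?_, fun ha => by rw [ha, one_smul]⟩
  refine (det_pinHom a).resolve_right fun hdet => (a : (Cl E)ˣ).ne_zero ?_
  rw [hdet, neg_one_smul, neg_eq_iff_add_eq_zero, ← two_smul ℝ, smul_eq_zero] at ha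
  exact ha.resolve_left two_ne_zero

theorem involute_coe_of_notMem_pinCover' (h : Even (Module.finrank ℝ E)) {a : Pin E}
    (ha : a ∈ pinCover W) (ha' : a ∉ pinCover' W) :
    CliffordAlgebra.involute ((a : (Cl E)ˣ) : Cl E) = -((a : (Cl E)ˣ) : Cl E) := by
  have hdet : LinearMap.det (pinHom E a : E →ₗ[ℝ] E) = -1 :=
    (det_pinHom a).resolve_left fun hd => ha' ⟨ha, (coe_mem_spinAlgebra_iff_of_even h a).2 hd⟩
  rw [involute_coe_pin, hdet, neg_one_smul]

theorem hasSpinParity_or_det_eq (a : Pin E) : HasSpinParity ((a : (Cl E)ˣ) : Cl E) ∨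
    LinearMap.det (pinHom E a : E →ₗ[ℝ] E) = (-1) ^ (Module.finrank ℝ E + 1) := by
  rw [HasSpinParity, involute_coe_pin, pow_succ, mul_neg_one]
  rcases neg_one_pow_eq_or ℝ (Module.finrank ℝ E) with h | h <;>
    rcases det_pinHom a with h' | h' <;> simp [h, h']

theorem HasSpinParity.coe_pin_inv {a : Pin E} (ha : HasSpinParity ((a : (Cl E)ˣ) : Cl E)) :
    HasSpinParity (((a⁻¹ : Pin E) : (Cl E)ˣ) : Cl E) := by
  have hstar : (((a⁻¹ : Pin E) : (Cl E)ˣ) : Cl E) = star ((a : (Cl E)ˣ) : Cl E) := a.2.2.symm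
  rw [HasSpinParity, hstar, CliffordAlgebra.star_def, ← CliffordAlgebra.reverse_involute, ha,
    map_smul, map_smul, ha, map_smul]

theorem spinForm_toSpinAlgebra_inv {g : pinCover' W}
    (hg : HasSpinParity (((g : Pin E) : (Cl E)ˣ) : Cl E)) (hfin : IsOfFinOrder (pinHom E g)) :
    spinForm (toSpinAlgebra W g) (toSpinAlgebra W g⁻¹) = detOneSub (pinHom E g) := by
  let Ψ : Cl E →ₐ[ℝ] Cl E :=
    AlgHom.ofLinearMap (spinOp (toSpinAlgebra W g) (toSpinAlgebra W g⁻¹))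
      (by simp [spinOp_apply, toSpinAlgebra])
      (fun x y => by simp [spinOp_apply, toSpinAlgebra, mul_assoc])
  have hΨ (ξ : E) : Ψ (clι E ξ) = clι E ((-(pinHom E g : E →ₗ[ℝ] E)) ξ) := by
    change spinOp (toSpinAlgebra W g) (toSpinAlgebra W g⁻¹) (clι E ξ) = _
    rw [LinearMap.neg_apply, map_neg, LinearEquiv.coe_coe, clι_pinHom, hg, spinOp_apply]
    rcases Nat.even_or_odd (Module.finrank ℝ E) with h | h
    · simp [toSpinAlgebra, spinTwist_of_even h, h.neg_one_pow, mul_assoc]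
    · simp [toSpinAlgebra, spinTwist_of_odd h, h.neg_one_pow, mul_assoc]
  have hneg : IsOfFinOrder (-1 : Module.End ℝ E) :=
    isOfFinOrder_iff_pow_eq_one.2 ⟨2, two_pos, neg_one_sq⟩
  have hu : IsOfFinOrder (-(pinHom E g : Module.End ℝ E)) := by
    rw [← neg_one_mul]
    exact (Commute.neg_one_left _).isOfFinOrder_mul hneg (isOfFinOrder_toLinearMap hfin)
  rw [detOneSub, sub_eq_add_neg, ← trace_eq_det_one_add hΨ hu]
  rfl

end PinCover

section SpinCharacter

variable {E : Type*} [NormedAddCommGroup E] [InnerProductSpace ℝ E] [FiniteDimensional ℝ E]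
  {S₁ S₂ : Type*} [AddCommGroup S₁] [Module ℂ S₁] [AddCommGroup S₂] [Module ℂ S₂]
  {ρ₁ : spinAlgebra E →ₐ[ℝ] Module.End ℂ S₁} {ρ₂ : spinAlgebra E →ₐ[ℝ] Module.End ℂ S₂}
  {W : Subgroup (E ≃ₗ[ℝ] E)}

theorem spinCharacter_sub_apply (g : pinCover' W) :
    (spinCharacter W ρ₁ - spinCharacter W ρ₂) g = traceDiff ρ₁ ρ₂ (toSpinAlgebra W g) := rfl

variable [FiniteDimensional ℂ S₁] [FiniteDimensional ℂ S₂]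

theorem spinCharacter_sub_eq_zero (hl : Odd (Module.finrank ℝ E)) (hρ₁ : IsSimpleModuleHom ρ₁)
    (hρ₂ : IsSimpleModuleHom ρ₂) {g : pinCover' W}
    (hg : LinearMap.det (pinHom E g : E →ₗ[ℝ] E) = 1) :
    (spinCharacter W ρ₁ - spinCharacter W ρ₂) g = 0 := by
  obtain ⟨f, hf⟩ := exists_isSpinSystem_of_odd hl
  let F : spinAlgebra E →ₐ[ℝ] spinAlgebra E :=
    (CliffordAlgebra.involute.comp (spinAlgebra E).val).codRestrict (spinAlgebra E) fun x => by
      simp [spinAlgebra_of_odd hl]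
  have hF : F (List.ofFn f).prod = -(List.ofFn f).prod := by
    have h := hf.hasSpinParity
    rw [HasSpinParity, hl.neg_one_pow, neg_one_smul] at h
    exact Subtype.ext h
  have hFg : F (toSpinAlgebra W g) = toSpinAlgebra W g :=
    Subtype.ext ((involute_coe_pin _).trans (by rw [hg, one_smul]; rfl))
  have h := hf.traceDiff_map_eq_neg hf.odd_length hρ₁ hρ₂ F hF (toSpinAlgebra W g)
  rw [hFg] at h
  exact self_eq_neg.1 h

theorem det_mul_spinCharacter (hl : Odd (Module.finrank ℝ E)) (hρ₁ : IsSimpleModuleHom ρ₁)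
    (hρ₂ : IsSimpleModuleHom ρ₂) (g : pinCover' W) :
    ((LinearMap.det ((coverProj W g : E ≃ₗ[ℝ] E) : E →ₗ[ℝ] E) : ℝ) : ℂ) *
      (spinCharacter W ρ₁ - spinCharacter W ρ₂) g =
        -(spinCharacter W ρ₁ - spinCharacter W ρ₂) g := by
  rw [coverProj_coe]
  rcases det_pinHom (g : Pin E) with h | h
  · rw [spinCharacter_sub_eq_zero hl hρ₁ hρ₂ h, mul_zero, neg_zero]
  · rw [h, Complex.ofReal_neg, Complex.ofReal_one, neg_one_mul]

theorem spinCharacter_conj [Nontrivial E] (he : Even (Module.finrank ℝ E))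
    (hρ₁ : IsSimpleModuleHom ρ₁) (hρ₂ : IsSimpleModuleHom ρ₂) {x : Pin E} (hx : x ∈ pinCover W)
    (hx' : x ∉ pinCover' W) {g h : pinCover' W} (hgh : (h : Pin E) = x * g * x⁻¹) :
    (spinCharacter W ρ₁ - spinCharacter W ρ₂) h = -(spinCharacter W ρ₁ - spinCharacter W ρ₂) g := by
  obtain ⟨m, f, hf⟩ := exists_isSpinSystem E
  have hodd := involute_coe_of_notMem_pinCover' he hx hx'
  have hodd_inv := involute_coe_of_notMem_pinCover' he (inv_mem hx) (mt inv_mem_iff.1 hx')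
  let c : Cl E →ₐ[ℝ] Cl E := MulSemiringAction.toAlgHom ℝ (Cl E) (ConjAct.toConjAct (x : (Cl E)ˣ))
  have hc (y : Cl E) : c y = ((x : (Cl E)ˣ) : Cl E) * y * (((x⁻¹ : Pin E) : (Cl E)ˣ) : Cl E) := rfl
  let F : spinAlgebra E →ₐ[ℝ] spinAlgebra E :=
    (c.comp (spinAlgebra E).val).codRestrict (spinAlgebra E) fun y => by
      rw [mem_spinAlgebra_iff_of_even he, AlgHom.comp_apply, Subalgebra.coe_val, hc, map_mul,
        map_mul, hodd, hodd_inv, (mem_spinAlgebra_iff_of_even he).1 y.2, neg_mul, neg_mul_neg]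
  have hFφ : F (List.ofFn f).prod = -(List.ofFn f).prod := by
    have h := hf.ofFn_prod_mul ((x : (Cl E)ˣ) : Cl E)
    rw [spinTwist_of_even he, hodd, neg_mul] at h
    refine Subtype.ext ((hc (List.ofFn f).prod).trans ?_)
    rw [← neg_eq_iff_eq_neg.2 h]
    simp [mul_assoc]
  have hFg : F (toSpinAlgebra W g) = toSpinAlgebra W h :=
    Subtype.ext (congrArg (fun y : Pin E => ((y : (Cl E)ˣ) : Cl E)) hgh).symm
  rw [spinCharacter_sub_apply, spinCharacter_sub_apply, ← hFg]
  exact hf.traceDiff_map_eq_neg hf.odd_length hρ₁ hρ₂ F hFφ _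

theorem spinCharacter_mul_inv [Nontrivial E] (hρ₁ : IsSimpleModuleHom ρ₁)
    (hρ₂ : IsSimpleModuleHom ρ₂) (hρ : ¬ AreIsomorphic ρ₁ ρ₂) {g : pinCover' W}
    (hg : IsOfFinOrder (pinHom E g)) :
    (spinCharacter W ρ₁ - spinCharacter W ρ₂) g * (spinCharacter W ρ₁ - spinCharacter W ρ₂) g⁻¹ =
      spinFactor E * detOneSub (coverProj W g : E ≃ₗ[ℝ] E) := by
  rw [coverProj_coe]
  rcases hasSpinParity_or_det_eq (g : Pin E) with h | h
  · rw [← spinForm_toSpinAlgebra_inv h hg]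
    exact traceDiff_mul_traceDiff hρ₁ hρ₂ hρ (toSpinAlgebra W g) h.coe_pin_inv
  · have hzero : (spinCharacter W ρ₁ - spinCharacter W ρ₂) g = 0 := by
      rcases Nat.even_or_odd (Module.finrank ℝ E) with hl | hl
      · rw [(coe_mem_spinAlgebra_iff_of_even hl g).1 g.2.2, hl.add_one.neg_one_pow] at h
        norm_num at h
      · exact spinCharacter_sub_eq_zero hl hρ₁ hρ₂ (by rw [h, hl.add_one.neg_one_pow])
    rw [hzero, detOneSub_eq_zero hg h, zero_mul, Complex.ofReal_zero, mul_zero]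

end SpinCharacter

/-! ### Averages over the pin cover -/

section Average

theorem sum_comp_eq_card_ker_mul {G H : Type*} [Group G] [Group H] [Fintype G] (φ : G →* H)
    [Fintype φ.range] (F : H → ℂ) :
    ∑ g, F (φ g) = Nat.card φ.ker * ∑ w : φ.range, F w := by
  classical
  rw [← Finset.sum_fiberwise (Finset.univ : Finset G) φ.rangeRestrict, Finset.mul_sum]
  refine Finset.sum_congr rfl fun w _ => ?_
  have hF : ∀ g ∈ Finset.univ.filter fun g => φ.rangeRestrict g = w, F (φ g) = F w := by
    intro g hg
    rw [← (Finset.mem_filter.1 hg).2]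
    rfl
  rw [Finset.sum_congr rfl hF, Finset.sum_const, nsmul_eq_mul]
  congr 2
  rw [MonoidHom.card_fiber_eq_of_mem_range φ.rangeRestrict (y := 1)
    (φ.rangeRestrict_surjective w) ⟨1, map_one _⟩, ← φ.ker_rangeRestrict,
    Nat.card_eq_fintype_card, Fintype.card_subtype]
  simp only [MonoidHom.mem_ker]

theorem inv_card_mul_sum_comp {G H : Type*} [Group G] [Group H] [Fintype G] (φ : G →* H)
    [Fintype φ.range] (F : H → ℂ) :
    (Nat.card G : ℂ)⁻¹ * ∑ g, F (φ g) = (Nat.card φ.range : ℂ)⁻¹ * ∑ w : φ.range, F w := by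
  have hcard : (Nat.card φ.ker : ℂ) * Nat.card φ.range = Nat.card G := by
    rw [← Subgroup.index_ker, ← Nat.cast_mul, Subgroup.card_mul_index]
  have hker : (Nat.card φ.ker : ℂ) ≠ 0 := Nat.cast_ne_zero.2 Nat.card_pos.ne'
  rw [sum_comp_eq_card_ker_mul, ← hcard, mul_inv, mul_mul_mul_comm, inv_mul_cancel₀ hker, one_mul]

variable {E : Type*} [NormedAddCommGroup E] [InnerProductSpace ℝ E] [FiniteDimensional ℝ E]
  {W : Subgroup (E ≃ₗ[ℝ] E)}

theorem coverProj_surjective_of_odd (hl : Odd (Module.finrank ℝ E))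
    (hW : ∀ w ∈ W, ∀ x y, inner ℝ (w x) (w y) = inner ℝ x y) :
    Function.Surjective (coverProj W) := by
  rintro ⟨w, hw⟩
  obtain ⟨a, rfl⟩ := exists_pinHom_eq (hW w hw)
  exact ⟨⟨a, hw, by simp [spinAlgebra_of_odd hl]⟩, rfl⟩

theorem mem_range_coverProj_iff_of_even (hl : Even (Module.finrank ℝ E))
    (hW : ∀ w ∈ W, ∀ x y, inner ℝ (w x) (w y) = inner ℝ x y) (w : W) :
    w ∈ (coverProj W).range ↔ LinearMap.det ((w : E ≃ₗ[ℝ] E) : E →ₗ[ℝ] E) = 1 := by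
  refine ⟨?_, fun hdet => ?_⟩
  · rintro ⟨g, rfl⟩
    exact (coe_mem_spinAlgebra_iff_of_even hl g).1 g.2.2
  · obtain ⟨w, hw⟩ := w
    obtain ⟨a, rfl⟩ := exists_pinHom_eq (hW w hw)
    exact ⟨⟨a, hw, (coe_mem_spinAlgebra_iff_of_even hl a).2 hdet⟩, rfl⟩

theorem card_eq_two_mul_card_range_coverProj (hl : Even (Module.finrank ℝ E))
    (hW : ∀ w ∈ W, ∀ x y, inner ℝ (w x) (w y) = inner ℝ x y)
    (hs : ∃ s ∈ W, LinearMap.det (s : E →ₗ[ℝ] E) = -1) :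
    Nat.card W = 2 * Nat.card (coverProj W).range := by
  obtain ⟨s, hsW, hs⟩ := hs
  rw [← (coverProj W).range.index_mul_card]
  congr 1
  rw [Subgroup.index_eq_two_iff]
  refine ⟨⟨s, hsW⟩, fun b => ?_⟩
  have hmul : LinearMap.det (((b * ⟨s, hsW⟩ : W) : E ≃ₗ[ℝ] E) : E →ₗ[ℝ] E) =
      -LinearMap.det ((b : E ≃ₗ[ℝ] E) : E →ₗ[ℝ] E) := by
    rw [← mul_neg_one, ← hs, ← map_mul]
    rfl
  rw [mem_range_coverProj_iff_of_even hl hW, mem_range_coverProj_iff_of_even hl hW, hmul]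
  rcases det_eq_one_or_neg_one_of_inner_map_map (hW b b.2) with h | h <;> rw [h] <;>
    norm_num [Xor]

theorem detOneSub_eq_zero_of_notMem_range [Finite W] (hl : Even (Module.finrank ℝ E))
    (hW : ∀ w ∈ W, ∀ x y, inner ℝ (w x) (w y) = inner ℝ x y) {w : W}
    (hw : w ∉ (coverProj W).range) : detOneSub (w : E ≃ₗ[ℝ] E) = 0 := by
  rw [mem_range_coverProj_iff_of_even hl hW] at hw
  refine detOneSub_eq_zero (W.subtype.isOfFinOrder (isOfFinOrder_of_finite w)) ?_
  rw [hl.add_one.neg_one_pow]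
  exact (det_eq_one_or_neg_one_of_inner_map_map (hW w w.2)).resolve_left hw

theorem inv_card_mul_sum_coverProj [Fintype W] [Fintype (pinCover' W)]
    (hW : ∀ w ∈ W, ∀ x y, inner ℝ (w x) (w y) = inner ℝ x y)
    (hdet : Even (Module.finrank ℝ E) → ∃ s ∈ W, LinearMap.det (s : E →ₗ[ℝ] E) = -1)
    {F : W → ℂ} (hF : ∀ w : W, detOneSub (w : E ≃ₗ[ℝ] E) = 0 → F w = 0) :
    (1 / 2) * spinFactor E * ((Nat.card (pinCover' W) : ℂ)⁻¹ * ∑ g, F (coverProj W g)) =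
      (Nat.card W : ℂ)⁻¹ * ∑ w, F w := by
  classical
  rw [inv_card_mul_sum_comp]
  have hsum (h : ∀ w : W, w ∉ (coverProj W).range → F w = 0) :
      ∑ w : (coverProj W).range, F w = ∑ w, F w := by
    rw [← Finset.sum_filter_of_ne (p := (· ∈ (coverProj W).range))
      fun w _ hw => not_not.1 fun hw' => hw (h w hw')]
    exact (Finset.sum_subtype _ (by simp) F).symm
  rcases Nat.even_or_odd (Module.finrank ℝ E) with hl | hl
  · rw [hsum fun w hw => hF w (detOneSub_eq_zero_of_notMem_range hl hW hw),
      card_eq_two_mul_card_range_coverProj hl hW (hdet hl), spinFactor,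
      if_neg (Nat.not_odd_iff_even.2 hl)]
    push_cast
    ring
  · have htop : (coverProj W).range = ⊤ :=
      MonoidHom.range_eq_top.2 (coverProj_surjective_of_odd hl hW)
    rw [hsum fun w hw => absurd (htop ▸ Subgroup.mem_top w) hw, spinFactor, if_pos hl, htop,
      Subgroup.card_top]
    push_cast
    ring

end Average

/-! ### The fake degree as a power series -/

section FakeDegree

open scoped LaurentSeries RatFunc

theorem coe_X_sub_one_pow_mul_sum_C_div {F ι : Type*} [Field F] (s : Finset ι) (n : ℕ) (c : F)
    (a : ι → F) {p : ι → Polynomial F} {H : ι → F⟦X⟧} (hp : ∀ i, H i * (p i : F⟦X⟧) = 1) :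
    (((RatFunc.X - 1) ^ n * (RatFunc.C c * ∑ i ∈ s, RatFunc.C (a i) /
      algebraMap (Polynomial F) (RatFunc F) (p i)) : RatFunc F) : F⸨X⸩) =
      (((PowerSeries.X - 1) ^ n * (PowerSeries.C c * ∑ i ∈ s, PowerSeries.C (a i) * H i) :
        F⟦X⟧) : F⸨X⸩) := by
  have hC (a : F) : algebraMap (RatFunc F) F⸨X⸩ (RatFunc.C a) =
      ((PowerSeries.C a : F⟦X⟧) : F⸨X⸩) := by
    rw [← RatFunc.algebraMap_C, ← Polynomial.coe_C]
    exact (RatFunc.coe_coe _).symm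
  have hX : algebraMap (RatFunc F) F⸨X⸩ RatFunc.X = ((PowerSeries.X : F⟦X⟧) : F⸨X⸩) := by
    rw [← RatFunc.algebraMap_X, ← Polynomial.coe_X]
    exact (RatFunc.coe_coe _).symm
  have hp' (i : ι) : (H i : F⸨X⸩) *
      algebraMap (RatFunc F) F⸨X⸩ (algebraMap (Polynomial F) (RatFunc F) (p i)) = 1 := by
    rw [← map_one (HahnSeries.ofPowerSeries ℤ F), ← hp i, map_mul]
    congr 1
    exact (RatFunc.coe_coe _).symm
  simp only [map_mul, map_pow, map_sub, map_one, map_sum, map_div₀, hC, hX]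
  congr 2
  refine Finset.sum_congr rfl fun i _ => ?_
  rw [div_eq_mul_inv, eq_comm, ← eq_inv_of_mul_eq_one_left (hp' i)]

variable {E : Type*} [AddCommGroup E] [Module ℝ E] [FiniteDimensional ℝ E]
  {W : Subgroup (E ≃ₗ[ℝ] E)}

theorem coe_ellipticFakeDegree [Finite W] (π : W → ℂ) :
    ((ellipticFakeDegree π : RatFunc ℂ) : ℂ⸨X⸩) =
      (((PowerSeries.X - 1) ^ Module.finrank ℝ E * PowerSeries.mk fun i =>
        ellipticPairing π fun w => symPowCharacter W i w⁻¹ : ℂ⟦X⟧) : ℂ⸨X⸩) := by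
  have := Fintype.ofFinite W
  have hinv (w : W) : (PowerSeries.mk fun i => symPowCharacter W i w⁻¹) *
      (detOneSubX (w : E ≃ₗ[ℝ] E) : ℂ⟦X⟧) = 1 := by
    have hw : IsOfFinOrder (w : E ≃ₗ[ℝ] E) := W.subtype.isOfFinOrder (isOfFinOrder_of_finite w)
    rw [← detOneSubX_inv hw]
    exact mk_trace_symPow_mul_detOneSubX hw.inv
  have hsum : (PowerSeries.mk fun i => ellipticPairing π fun w => symPowCharacter W i w⁻¹) =
      PowerSeries.C (Nat.card W : ℂ)⁻¹ *
        ∑ w : W, PowerSeries.C (π w * (detOneSub (w : E ≃ₗ[ℝ] E) : ℂ)) *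
          PowerSeries.mk fun i => symPowCharacter W i w⁻¹ := by
    ext i
    simp only [PowerSeries.coeff_mk, PowerSeries.coeff_C_mul, map_sum, ellipticPairing,
      finsum_eq_sum_of_fintype, mul_right_comm]
  rw [ellipticFakeDegree, finsum_eq_sum_of_fintype, hsum]
  exact coe_X_sub_one_pow_mul_sum_C_div Finset.univ _ _ _ hinv

end FakeDegree

/-! ### Spin pairs -/

section SpinPairs

theorem nontrivial_of_exists_det_eq_neg_one {E : Type*} [AddCommGroup E] [Module ℝ E]
    {W : Subgroup (E ≃ₗ[ℝ] E)} (hdet : Even (Module.finrank ℝ E) →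
      ∃ w ∈ W, LinearMap.det (w : E →ₗ[ℝ] E) = -1) : Nontrivial E := by
  by_contra h
  have := not_nontrivial_iff_subsingleton.1 h
  obtain ⟨w, -, hw⟩ := hdet (by simp [Module.finrank_zero_of_subsingleton])
  rw [LinearMap.det_eq_one_of_subsingleton] at hw
  norm_num at hw

variable {E : Type*} [NormedAddCommGroup E] [InnerProductSpace ℝ E] [FiniteDimensional ℝ E]
  {W : Subgroup (E ≃ₗ[ℝ] E)}

theorem IsGenuineCharacter.isCharacter {χ : pinCover' W → ℂ} (h : IsGenuineCharacter W χ) :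
    IsCharacter (pinCover' W) χ :=
  IsCharacterOn.isCharacter h

theorem coverProj_eq_one {z : pinCover' W} (hz : (((z : Pin E) : (Cl E)ˣ) : Cl E) = -1) :
    coverProj W z = 1 := by
  have hu : ((z : Pin E) : (Cl E)ˣ) = -1 := Units.ext (by rw [hz]; simp)
  refine Subtype.ext (LinearEquiv.ext fun ξ => clι_injective E ?_)
  rw [coverProj_coe, clι_pinHom, hu]
  simp

theorem IsGenuineCharacter.add {χ ψ : pinCover' W → ℂ} (hχ : IsGenuineCharacter W χ)
    (hψ : IsGenuineCharacter W ψ) : IsGenuineCharacter W (χ + ψ) :=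
  IsCharacterOn.add hχ hψ

theorem IsGenuineCharacter.spinInduct {ψ : pinCover' W → ℂ} (hψ : IsGenuineCharacter W ψ)
    {χ : W → ℂ} (hχ : IsCharacter W χ) : IsGenuineCharacter W (spinInduct W ψ χ) :=
  hχ.comp_mul hψ (coverProj W) fun _ => coverProj_eq_one

theorem conj_mem_pinCover' (he : Even (Module.finrank ℝ E)) {x g : Pin E} (hx : x ∈ pinCover W)
    (hg : g ∈ pinCover' W) : x * g * x⁻¹ ∈ pinCover' W := by
  refine ⟨mul_mem (mul_mem hx hg.1) (inv_mem hx), ?_⟩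
  rw [coe_mem_spinAlgebra_iff_of_even he, det_pinHom_mul, det_pinHom_mul, mul_right_comm,
    ← det_pinHom_mul, mul_inv_cancel, map_one, (coe_mem_spinAlgebra_iff_of_even he g).1 hg.2,
    mul_one]
  exact LinearMap.det_id

/-- The automorphism `g ↦ x g x⁻¹` of `W̃'` for `x ∈ W̃`, in even dimension; the associate of a
genuine character is its composition with this automorphism when `x ∉ W̃'`. -/
def conjPinCover' (he : Even (Module.finrank ℝ E)) {x : Pin E} (hx : x ∈ pinCover W) :
    pinCover' W ≃* pinCover' W where
  toFun g := ⟨x * g * x⁻¹, conj_mem_pinCover' he hx g.2⟩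
  invFun g := ⟨x⁻¹ * g * x, by simpa using conj_mem_pinCover' he (inv_mem hx) g.2⟩
  left_inv g := Subtype.ext (by simp [mul_assoc])
  right_inv g := Subtype.ext (by simp [mul_assoc])
  map_mul' g h := Subtype.ext (by simp [mul_assoc])

theorem coverProj_conjPinCover' (he : Even (Module.finrank ℝ E)) {x : Pin E}
    (hx : x ∈ pinCover W) (g : pinCover' W) :
    coverProj W (conjPinCover' he hx g) = ⟨pinHom E x, hx⟩ * coverProj W g * ⟨pinHom E x, hx⟩⁻¹ :=
  Subtype.ext (by rw [coverProj_coe]; simp [conjPinCover', coverProj_coe])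

variable {S₁ S₂ : Type*} [AddCommGroup S₁] [Module ℂ S₁] [FiniteDimensional ℂ S₁]
  [AddCommGroup S₂] [Module ℂ S₂] [FiniteDimensional ℂ S₂]
  {ρ₁ : spinAlgebra E →ₐ[ℝ] Module.End ℂ S₁} {ρ₂ : spinAlgebra E →ₐ[ℝ] Module.End ℂ S₂}

theorem isGenuineCharacter_spinCharacter (ρ : spinAlgebra E →ₐ[ℝ] Module.End ℂ S₁) :
    IsGenuineCharacter W (spinCharacter W ρ) := by
  let τ : Representation ℂ (pinCover' W) S₁ :=
    { toFun := fun g => ρ (toSpinAlgebra W g)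
      map_one' := by rw [← map_one ρ]; rfl
      map_mul' := fun g h => by rw [← map_mul ρ]; rfl }
  refine isCharacterOn_character (ρ := τ) fun z hz => ?_
  have hz' : toSpinAlgebra W z = -1 := Subtype.ext hz
  change ρ (toSpinAlgebra W z) = -1
  rw [hz', map_neg, map_one]

theorem exists_spinInduct_eq_sub [Finite W] (ρ₁ : spinAlgebra E →ₐ[ℝ] Module.End ℂ S₁)
    (ρ₂ : spinAlgebra E →ₐ[ℝ] Module.End ℂ S₂) {π : W → ℂ} (hπ : π ∈ virtualCharacters W) :
    ∃ s t, IsGenuineCharacter W s ∧ IsGenuineCharacter W t ∧ charPairing s t = 0 ∧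
      spinInduct W (spinCharacter W ρ₁ - spinCharacter W ρ₂) π = s - t := by
  obtain ⟨a, b, ha, hb, rfl⟩ := exists_sub_of_mem_virtualCharacters hπ
  have h₁ := isGenuineCharacter_spinCharacter (W := W) ρ₁
  have h₂ := isGenuineCharacter_spinCharacter (W := W) ρ₂
  obtain ⟨s, t, hs, ht, hst, hsub⟩ := exists_orthogonal_parts
    ((h₁.spinInduct ha).add (h₂.spinInduct hb)) ((h₂.spinInduct ha).add (h₁.spinInduct hb))
  refine ⟨s, t, hs, ht, hst, ?_⟩
  rw [hsub]
  ext g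
  simp only [spinInduct, Pi.sub_apply, Pi.add_apply]
  ring

theorem eq_det_mul_of_spinInduct_eq_sub [Finite W] (hl : Odd (Module.finrank ℝ E))
    (hρ₁ : IsSimpleModuleHom ρ₁) (hρ₂ : IsSimpleModuleHom ρ₂) {π : W → ℂ}
    {s t : pinCover' W → ℂ} (hs : IsCharacter (pinCover' W) s)
    (ht : IsCharacter (pinCover' W) t) (hst : charPairing s t = 0)
    (h : spinInduct W (spinCharacter W ρ₁ - spinCharacter W ρ₂) π = s - t) (g : pinCover' W) :
    t g = ((LinearMap.det ((coverProj W g : E ≃ₗ[ℝ] E) : E →ₗ[ℝ] E) : ℝ) : ℂ) * s g := by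
  let d : pinCover' W →* ℂ := (Complex.ofRealHom : ℝ →* ℂ).comp <| LinearMap.det.comp <|
    (LinearEquiv.automorphismGroup.toLinearMapMonoidHom (R := ℝ) (M := E)).comp <|
      W.subtype.comp (coverProj W)
  refine (congrFun (mul_eq_of_mul_sub_eq_neg hs ht hst d ?_) g).symm
  rw [← h]
  ext g
  exact (mul_left_comm _ _ _).trans <|
    (congrArg _ (det_mul_spinCharacter hl hρ₁ hρ₂ g)).trans (mul_neg _ _)

theorem apply_conj_eq_of_spinInduct_eq_sub [Finite W] [Nontrivial E]
    (he : Even (Module.finrank ℝ E)) (hρ₁ : IsSimpleModuleHom ρ₁) (hρ₂ : IsSimpleModuleHom ρ₂)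
    {π : W → ℂ} (hπ : π ∈ virtualCharacters W) {s t : pinCover' W → ℂ}
    (hs : IsCharacter (pinCover' W) s) (ht : IsCharacter (pinCover' W) t)
    (hst : charPairing s t = 0)
    (h : spinInduct W (spinCharacter W ρ₁ - spinCharacter W ρ₂) π = s - t) {x : Pin E}
    (hx : x ∈ pinCover W) (hx' : x ∉ pinCover' W) {g k : pinCover' W}
    (hk : (k : Pin E) = x * g * x⁻¹) : t k = s g := by
  have hkg : k = conjPinCover' he hx g := Subtype.ext hk
  rw [hkg]
  refine congrFun (comp_eq_of_sub_comp_eq_neg hs ht hst (conjPinCover' he hx) ?_) g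
  rw [← h]
  ext g
  change π (coverProj W (conjPinCover' he hx g)) * _ = -(π (coverProj W g) * _)
  rw [coverProj_conjPinCover', apply_conj_of_mem_virtualCharacters hπ,
    spinCharacter_conj he hρ₁ hρ₂ hx hx' (g := g) rfl, mul_neg]

theorem isAssociate_of_spinInduct_eq_sub [Finite W] [Nontrivial E] (hρ₁ : IsSimpleModuleHom ρ₁)
    (hρ₂ : IsSimpleModuleHom ρ₂) {π : W → ℂ} (hπ : π ∈ virtualCharacters W)
    {s t : pinCover' W → ℂ} (hs : IsCharacter (pinCover' W) s)
    (ht : IsCharacter (pinCover' W) t) (hst : charPairing s t = 0)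
    (h : spinInduct W (spinCharacter W ρ₁ - spinCharacter W ρ₂) π = s - t) :
    IsAssociate W s t :=
  ⟨fun hl => eq_det_mul_of_spinInduct_eq_sub hl hρ₁ hρ₂ hs ht hst h,
    fun he _ hx hx' _ _ => apply_conj_eq_of_spinInduct_eq_sub he hρ₁ hρ₂ hπ hs ht hst h hx hx'⟩

variable [Finite W] [Nontrivial E] (hρ₁ : IsSimpleModuleHom ρ₁) (hρ₂ : IsSimpleModuleHom ρ₂)
  (hρ : ¬ AreIsomorphic ρ₁ ρ₂) (hW : ∀ w ∈ W, ∀ x y, inner ℝ (w x) (w y) = inner ℝ x y)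
  (hdet : Even (Module.finrank ℝ E) → ∃ w ∈ W, LinearMap.det (w : E →ₗ[ℝ] E) = -1)
include hρ₁ hρ₂ hρ hW hdet

theorem half_mul_charPairing_spinInduct (π χ : W → ℂ) :
    (1 / 2) * charPairing (spinInduct W (spinCharacter W ρ₁ - spinCharacter W ρ₂) π)
        (spinInduct W (spinCharacter W ρ₁ - spinCharacter W ρ₂) χ) =
      ellipticPairing π fun w => χ w⁻¹ := by
  have := Fintype.ofFinite W
  have := Fintype.ofFinite (pinCover' W)
  set δ := spinCharacter W ρ₁ - spinCharacter W ρ₂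
  let F : W → ℂ := fun w => π w * χ w⁻¹ * detOneSub (w : E ≃ₗ[ℝ] E)
  have hF (g : pinCover' W) : spinInduct W δ π g * spinInduct W δ χ g⁻¹ =
      spinFactor E * F (coverProj W g) := by
    have hg : δ g * δ g⁻¹ = _ := spinCharacter_mul_inv hρ₁ hρ₂ hρ (isOfFinOrder_pinHom g)
    simp only [spinInduct, map_inv, F]
    linear_combination π (coverProj W g) * χ (coverProj W g)⁻¹ * hg
  rw [charPairing_eq_sum, Finset.sum_congr rfl fun g _ => hF g, ← Finset.mul_sum,
    mul_left_comm _ (spinFactor E : ℂ), ← mul_assoc, inv_card_mul_sum_coverProj hW hdet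
      fun w hw => by simp only [F, hw, Complex.ofReal_zero, mul_zero],
    ellipticPairing, finsum_eq_sum_of_fintype]

theorem spinInduct_eq_zero_of_mem_ellipticRadical {r : virtualCharacters W}
    (hr : r ∈ ellipticRadical W) :
    spinInduct W (spinCharacter W ρ₁ - spinCharacter W ρ₂) (r : W → ℂ) = 0 := by
  obtain ⟨s, t, hs, ht, -, hst⟩ := exists_spinInduct_eq_sub ρ₁ ρ₂ r.2
  have hmem : spinInduct W (spinCharacter W ρ₁ - spinCharacter W ρ₂) (r : W → ℂ) ∈
      virtualCharacters (pinCover' W) := by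
    rw [hst]
    exact sub_mem (AddSubgroup.subset_closure hs.isCharacter)
      (AddSubgroup.subset_closure ht.isCharacter)
  refine eq_zero_of_charPairing_self_eq_neg hmem (n := 0) ?_
  have hnorm := half_mul_charPairing_spinInduct hρ₁ hρ₂ hρ hW hdet r r
  rw [hr ⟨_, inv_mem_virtualCharacters r.2⟩] at hnorm
  simpa using hnorm

theorem spinInduct_eq_of_mk_eq {π π' : virtualCharacters W}
    (h : (QuotientAddGroup.mk π : EllipticQuotient W) = QuotientAddGroup.mk π') :
    spinInduct W (spinCharacter W ρ₁ - spinCharacter W ρ₂) (π : W → ℂ) =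
      spinInduct W (spinCharacter W ρ₁ - spinCharacter W ρ₂) (π' : W → ℂ) := by
  have hzero :=
    spinInduct_eq_zero_of_mem_ellipticRadical hρ₁ hρ₂ hρ hW hdet (QuotientAddGroup.eq.1 h)
  ext g
  have hg := congrFun hzero g
  simp only [spinInduct, AddSubgroup.coe_add, AddSubgroup.coe_neg, Pi.add_apply, Pi.neg_apply,
    Pi.zero_apply] at hg ⊢
  linear_combination -hg

theorem existsUnique_isSpinPair (c : EllipticQuotient W) :
    ∃! σ : (pinCover' W → ℂ) × (pinCover' W → ℂ),
      IsSpinPair W (spinCharacter W ρ₁ - spinCharacter W ρ₂) c σ := by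
  obtain ⟨π, rfl⟩ := QuotientAddGroup.mk_surjective c
  obtain ⟨s, t, hs, ht, hst, hπ⟩ := exists_spinInduct_eq_sub ρ₁ ρ₂ π.2
  refine ⟨(s, t), ⟨hs, ht, isAssociate_of_spinInduct_eq_sub hρ₁ hρ₂ π.2 hs.isCharacter
    ht.isCharacter hst hπ, hst, fun π' h =>
      (spinInduct_eq_of_mk_eq hρ₁ hρ₂ hρ hW hdet h).trans hπ⟩, ?_⟩
  rintro ⟨s', t'⟩ h
  obtain ⟨hs', ht'⟩ := orthogonal_parts_unique h.genuine_fst.isCharacter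
    h.genuine_snd.isCharacter hs.isCharacter ht.isCharacter h.orthogonal hst
    ((h.induct_eq π rfl).symm.trans hπ)
  exact Prod.ext hs' ht'

theorem C_half_mul_symPairing_spinInduct (π : W → ℂ) :
    PowerSeries.C (1 / 2 : ℂ) * symPairing W
        (spinInduct W (spinCharacter W ρ₁ - spinCharacter W ρ₂) π)
        (spinCharacter W ρ₁ - spinCharacter W ρ₂) =
      PowerSeries.mk fun i => ellipticPairing π fun w => symPowCharacter W i w⁻¹ := by
  ext i
  rw [PowerSeries.coeff_C_mul, symPairing, PowerSeries.coeff_mk, PowerSeries.coeff_mk,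
    half_mul_charPairing_spinInduct hρ₁ hρ₂ hρ hW hdet]

end SpinPairs

/-! ### The Weyl group as an orthogonal group -/

section Weyl

theorem inner_map_map_of_mem_weylGroup {I E N : Type*} [NormedAddCommGroup E]
    [InnerProductSpace ℝ E] [AddCommGroup N] [Module ℝ N] {P : RootPairing I ℝ E N}
    (hP : ∀ (i : I) (x y : E), inner ℝ (P.reflection i x) (P.reflection i y) = inner ℝ x y)
    {w : E ≃ₗ[ℝ] E} (hw : w ∈ weylGroup P) (x y : E) : inner ℝ (w x) (w y) = inner ℝ x y := by
  induction hw using Subgroup.closure_induction'' generalizing x y with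
  | one => rfl
  | mem w hw =>
    obtain ⟨i, rfl⟩ := hw
    exact hP i x y
  | inv_mem w hw =>
    obtain ⟨i, rfl⟩ := hw
    rw [P.reflection_inv, hP]
  | mul v w _ _ hv hw => rw [LinearEquiv.mul_apply, LinearEquiv.mul_apply, hv, hw]

theorem exists_mem_weylGroup_det_eq_neg_one {I E N : Type*} [Nonempty I] [AddCommGroup E]
    [Module ℝ E] [FiniteDimensional ℝ E] [AddCommGroup N] [Module ℝ N]
    (P : RootPairing I ℝ E N) : ∃ w ∈ weylGroup P, LinearMap.det (w : E →ₗ[ℝ] E) = -1 := by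
  obtain ⟨i⟩ := ‹Nonempty I›
  refine ⟨P.reflection i, Subgroup.subset_closure ⟨i, rfl⟩, ?_⟩
  have hrefl : (P.reflection i : E →ₗ[ℝ] E) =
      LinearMap.transvection (P.coroot' i) (-P.root i) := by
    ext x
    simp [LinearMap.transvection.apply, P.reflection_apply, sub_eq_add_neg]
  rw [hrefl, LinearMap.transvection.det, map_neg, P.root_coroot'_eq_pairing, P.pairing_same]
  norm_num

end Weyl

end EllipticSpin

end

theorem mainTheorem8_general {E : Type*} [NormedAddCommGroup E] [InnerProductSpace ℝ E]
    [FiniteDimensional ℝ E] (W : Subgroup (E ≃ₗ[ℝ] E)) [Finite W]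
    (hW : ∀ w ∈ W, ∀ x y, inner ℝ (w x) (w y) = inner ℝ x y)
    (hdet : Even (Module.finrank ℝ E) → ∃ w ∈ W, LinearMap.det (w : E →ₗ[ℝ] E) = -1)
    {S₁ S₂ : Type*} [AddCommGroup S₁] [Module ℂ S₁] [FiniteDimensional ℂ S₁]
    [AddCommGroup S₂] [Module ℂ S₂] [FiniteDimensional ℂ S₂]
    (ρ₁ : spinAlgebra E →ₐ[ℝ] Module.End ℂ S₁) (ρ₂ : spinAlgebra E →ₐ[ℝ] Module.End ℂ S₂)
    (hρ₁ : IsSimpleModuleHom ρ₁) (hρ₂ : IsSimpleModuleHom ρ₂) (hρ : ¬ AreIsomorphic ρ₁ ρ₂)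
    (δ : pinCover' W → ℂ) (hδ : δ = spinCharacter W ρ₁ - spinCharacter W ρ₂)
    (c : EllipticQuotient W) :
    (∃! σ : (pinCover' W → ℂ) × (pinCover' W → ℂ), IsSpinPair W δ c σ) ∧
    ∀ σ, IsSpinPair W δ c σ →
      ∀ π : virtualCharacters W, (QuotientAddGroup.mk π : EllipticQuotient W) = c →
        ((ellipticFakeDegree (π : W → ℂ) : RatFunc ℂ) : ℂ⸨X⸩) =
          ((PowerSeries.C (1 / 2 : ℂ) * (PowerSeries.X - 1) ^ Module.finrank ℝ E *
            symPairing W (σ.1 - σ.2) δ : ℂ⟦X⟧) : ℂ⸨X⸩) := by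
  have : Nontrivial E := nontrivial_of_exists_det_eq_neg_one hdet
  subst hδ
  refine ⟨existsUnique_isSpinPair hρ₁ hρ₂ hρ hW hdet c, fun σ hσ π hπ => ?_⟩
  rw [coe_ellipticFakeDegree, ← hσ.induct_eq π hπ, mul_right_comm,
    C_half_mul_symPairing_spinInduct hρ₁ hρ₂ hρ hW hdet, mul_comm]

theorem mainTheorem8
    {I E N : Type*} [Finite I] [Nonempty I]
    [NormedAddCommGroup E] [InnerProductSpace ℝ E] [FiniteDimensional ℝ E]
    [AddCommGroup N] [Module ℝ N]
    (P : RootPairing I ℝ E N) [P.IsRootSystem] [P.IsCrystallographic]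
    (hP : ∀ (i : I) (x y : E), inner ℝ (P.reflection i x) (P.reflection i y) = inner ℝ x y)
    {S₁ S₂ : Type*} [AddCommGroup S₁] [Module ℂ S₁] [FiniteDimensional ℂ S₁]
    [AddCommGroup S₂] [Module ℂ S₂] [FiniteDimensional ℂ S₂]
    (ρ₁ : spinAlgebra E →ₐ[ℝ] Module.End ℂ S₁)
    (ρ₂ : spinAlgebra E →ₐ[ℝ] Module.End ℂ S₂)
    (hρ₁ : IsSimpleModuleHom ρ₁) (hρ₂ : IsSimpleModuleHom ρ₂)
    (hρ : ¬ AreIsomorphic ρ₁ ρ₂)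
    (δ : pinCover' (weylGroup P) → ℂ)
    (hδ : δ = spinCharacter (weylGroup P) ρ₁ -
      spinCharacter (weylGroup P) ρ₂)
    (c : EllipticQuotient (weylGroup P)) :
    (∃! σ : (pinCover' (weylGroup P) → ℂ) × (pinCover' (weylGroup P) → ℂ),
      IsSpinPair (weylGroup P) δ c σ) ∧
    ∀ σ, IsSpinPair (weylGroup P) δ c σ →
      ∀ π : virtualCharacters (weylGroup P),
        (QuotientAddGroup.mk π : EllipticQuotient (weylGroup P)) = c →
        ((ellipticFakeDegree (π : weylGroup P → ℂ) : RatFunc ℂ) : ℂ⸨X⸩) =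
          ((PowerSeries.C (1 / 2 : ℂ) * (PowerSeries.X - 1) ^ Module.finrank ℝ E *
            symPairing (weylGroup P) (σ.1 - σ.2) δ : ℂ⟦X⟧) : ℂ⸨X⸩) := by
  exact mainTheorem8_general (weylGroup P) (fun _ hw => inner_map_map_of_mem_weylGroup hP hw)
    (fun _ => exists_mem_weylGroup_det_eq_neg_one P) ρ₁ ρ₂ hρ₁ hρ₂ hρ δ hδ c
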